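/- Let $\mathcal S$ and $\mathcal A$ be finite sets and $\lambda$ a measure on $[0,1]$. An MDP $\phi=(p_\phi,q_\phi)$ consists, for all $(x,a)\in\mathcal S\times\mathcal A$, of a probability distribution $p_\phi(\cdot\mid x,a)$ on $\mathcal S$ (next state) and a probability distribution $q_\phi(\cdot\mid x,a)\ll\lambda$ on $[0,1]$ (reward), of mean $r_\phi(x,a)$. A policy $\pi\in\Pi$ selects the action $A_t$ as a measurable function of $(X_1,A_1,R_1,\dots,X_{t-1},A_{t-1},R_{t-1},X_t)$, where $X_t,A_t,R_t$ are the state, action and reward at step $t$. Put $V_T^\pi(x)=\mathbb E^\pi_x[\sum_{t=1}^T R_t]$ for the initial state $X_1=x$, and define the regret $R^\pi_T(x)=\sup_{\pi'\in\Pi}V_T^{\pi'}(x)-V_T^\pi(x)$ (both depend on $\phi$). The MDP $\phi$ is ergodic if every stationary deterministic policy $f:\mathcal S\to\mathcal A$ induces an irreducible Markov chain. Let $\Phi$ be an arbitrary set of MDPs (the structure). A policy $\pi$ is uniformly good if $R_T^\pi(x)=o(T^\alpha)$ as $T\to\infty$ for every ergodic MDP of $\Phi$, every initial state $x$ and every $\alpha>0$.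 The gain of $\pi$ from $x$ is $g^\pi_\phi(x)=\lim_{T\to\infty} V_T^\pi(x)/T$, when this limit exists, and $\Pi^*(\phi)$ is the set of stationary deterministic policies whose gain from every state is maximal over $\Pi$. The bias function of a stationary policy $f$ is the Cesàro limit $h^f_\phi(x)=\text{C-}\lim_{T\to\infty}\mathbb E_x^f[\sum_{t=1}^T(R_t-g^f_\phi(X_t))]$, and $h^*_\phi$ is the bias function of some $f\in\Pi^*(\phi)$ (for ergodic $\phi$ it is unique up to an additive constant). With $(\mathbf B^a_\phi h)(x)=r_\phi(x,a)+\sum_y p_\phi(y\mid x,a)h(y)$ and $\mathbf B^*_\phi h=\max_a\mathbf B^a_\phi h$, let $$\delta^*(x,a;\phi)=(\mathbf B^*_\phi h^*_\phi)(x)-(\mathbf B^a_\phi h^*_\phi)(x),\qquad \mathcal O(x;\phi)=\{a:\delta^*(x,a;\phi)=0\}.$$ Write $\phi\ll\psi$ if $p_\phi(\cdot\mid x,a)\ll p_\psi(\cdot\mid x,a)$ and $q_\phi(\cdot\mid x,a)\ll q_\psi(\cdot\mid x,a)$ for all $(x,a)$, and let $$\mathrm{KL}_{\phi\mid\psi}(x,a)=\mathrm{KL}\big(p_\phi(\cdot\mid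 x,a)\,\|\,p_\psi(\cdot\mid x,a)\big)+\mathrm{KL}\big(q_\phi(\cdot\mid x,a)\,\|\,q_\psi(\cdot\mid x,a)\big)\in[0,\infty].$$ The set $\Delta_\Phi(\phi)$ of confusing MDPs consists of the $\psi\in\Phi$ such that $\phi\ll\psi$, $\mathrm{KL}_{\phi\mid\psi}(x,a)=0$ for all $x$ and all $a\in\mathcal O(x;\phi)$, and $\Pi^*(\phi)\cap\Pi^*(\psi)=\emptyset$. Theorem. Let $\phi\in\Phi$ be ergodic. For every uniformly good policy $\pi\in\Pi$ and every $x\in\mathcal S$, the regret under $\phi$ satisfies $$\liminf_{T\to\infty}\frac{R_T^\pi(x)}{\log T}\ \ge\ K_\Phi(\phi):=\inf_{\eta\in\mathcal F_\Phi(\phi)}\ \sum_{(x',a)\in\mathcal S\times\mathcal A}\eta(x',a)\,\delta^*(x',a;\phi),$$ where $\mathcal F_\Phi(\phi)$ is the set of $\eta:\mathcal S\times\mathcal A\to[0,\infty]$ with $\sum_{(x',a)}\eta(x',a)\,\mathrm{KL}_{\phi\mid\psi}(x',a)\ge1$ for all $\psi\in\Delta_\Phi(\phi)$, with the convention $0\cdot\infty=0$.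 Both sides may be $+\infty$. -/

import Mathlib

open MeasureTheory ProbabilityTheory Filter Topology
open scoped ENNReal

noncomputable section

namespace StructuredMDP

/-- A Markov decision process with state space `S`, action space `A` and rewards in `[0,1]`: a
transition kernel `p(· | x, a)` on `S` and a reward kernel `q(· | x, a)` on `[0,1]`, the latter
absolutely continuous with respect to a reference measure `lam` on `[0,1]`. -/
structure MDP (S A : Type*) [MeasurableSpace S] [MeasurableSpace A]
    (lam : Measure unitInterval) where
  trans : Kernel (S × A) S
  reward : Kernel (S × A) unitInterval
  markov_trans : IsMarkovKernel trans
  markov_reward : IsMarkovKernel reward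
  reward_ac : ∀ z, reward z ≪ lam

attribute [instance] MDP.markov_trans MDP.markov_reward

/-- One step of the interaction: state, action, collected reward. -/
abbrev Obs (S A : Type*) : Type _ := S × A × unitInterval

/-- A (non-anticipating, history-dependent) policy: when `n` steps have been completed, it selects
the next action as a measurable function of the observations of these `n` steps and of the current
state. -/
structure Policy (S A : Type*) [MeasurableSpace S] [MeasurableSpace A] where
  act : (n : ℕ) → (Fin n → Obs S A) → S → A
  measurable_act : ∀ n, Measurable (fun z : (Fin n → Obs S A) × S => act n z.1 z.2)

variable {S A : Type*} [Fintype S] [MeasurableSpace S] [MeasurableSingletonClass S]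
  [Fintype A] [MeasurableSpace A] [MeasurableSingletonClass A] {lam : Measure unitInterval}

/-- The stationary deterministic policy that plays `f x` in state `x`. -/
def Policy.stationary (f : S → A) : Policy S A where
  act _ _ x := f x
  measurable_act _ := (measurable_of_countable f).comp measurable_snd

/-! ### The law of the observations -/

/-- Law of the next state given the observations so far, the initial state being `x`. -/
def nextState (φ : MDP S A lam) (x : S) : (n : ℕ) → Kernel (Fin n → Obs S A) S
  | 0 => Kernel.const _ (Measure.dirac x)
  | n + 1 => φ.trans.comap
      (fun h : Fin (n + 1) → Obs S A => ((h (Fin.last n)).1, (h (Fin.last n)).2.1))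
      (by fun_prop)

/-- Law of the next observation (state, action, reward) given the observations so far. -/
def nextObs (φ : MDP S A lam) (π : Policy S A) (x : S) (n : ℕ) :
    Kernel (Fin n → Obs S A) (Obs S A) :=
  nextState φ x n ⊗ₖ
    (Kernel.deterministic _ (π.measurable_act n) ⊗ₖ
      φ.reward.comap (fun z : ((Fin n → Obs S A) × S) × A => (z.1.2, z.2)) (by fun_prop))

/-- Law of the first `n` observations under the policy `π` in the MDP `φ`, started in `x`. -/
def law (φ : MDP S A lam) (π : Policy S A) (x : S) : (n : ℕ) → Measure (Fin n → Obs S A)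
  | 0 => Measure.dirac (fun i => i.elim0)
  | n + 1 => (law φ π x n ⊗ₘ nextObs φ π x n).map
      (fun z => (Fin.snoc z.1 z.2 : Fin (n + 1) → Obs S A))

/-! ### Value and regret -/

/-- `V_T^π(x)`: expected cumulative reward over `T` steps. -/
def value (φ : MDP S A lam) (π : Policy S A) (T : ℕ) (x : S) : ℝ :=
  ∫ h, ∑ i, ((h i).2.2 : ℝ) ∂(law φ π x T)

/-- `R_T^π(x) = sup_π' V_T^π'(x) - V_T^π(x)`. -/
def regret (φ : MDP S A lam) (π : Policy S A) (T : ℕ) (x : S) : ℝ :=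
  (⨆ π' : Policy S A, value φ π' T x) - value φ π T x

/-- Under every stationary policy, the induced Markov chain is irreducible. -/
def IsErgodic (φ : MDP S A lam) : Prop :=
  ∀ f : S → A, (Matrix.of fun x y => (φ.trans (x, f x)).real {y}).IsIrreducible

/-- `π` is uniformly good for the structure `Φ`. -/
def UniformlyGood (Φ : Set (MDP S A lam)) (π : Policy S A) : Prop :=
  ∀ φ ∈ Φ, IsErgodic φ → ∀ x : S, ∀ α : ℝ, 0 < α →
    (fun T : ℕ => regret φ π T x) =o[atTop] (fun T : ℕ => (T : ℝ) ^ α)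

/-! ### Gain, bias, optimal actions, gaps -/

/-- `g` is the gain (long-term average reward) of `π` started from `x`. -/
def HasGain (φ : MDP S A lam) (π : Policy S A) (x : S) (g : ℝ) : Prop :=
  Tendsto (fun T : ℕ => value φ π T x / T) atTop (𝓝 g)

/-- `Π*(φ)`: the stationary policies of maximal gain among all policies, from every state. -/
def optimalPolicies (φ : MDP S A lam) : Set (S → A) :=
  {f | ∀ x, ∃ g, HasGain φ (Policy.stationary f) x g ∧
    ∀ (π : Policy S A) (g' : ℝ), HasGain φ π x g' → g' ≤ g}

/-- `h` is the bias function of the stationary policy `f`: `h x` is the Cesàro limit, as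
`T → ∞`, of the expectation of `∑_{t ≤ T} (R_t - g(X_t))`, where `g` is the gain of `f`. -/
def HasBias (φ : MDP S A lam) (f : S → A) (h : S → ℝ) : Prop :=
  ∃ g : S → ℝ, (∀ x, HasGain φ (Policy.stationary f) x (g x)) ∧
    ∀ x, Tendsto
      (fun N : ℕ => (∑ T ∈ Finset.Icc 1 N,
        ∫ z, ∑ i, (((z i).2.2 : ℝ) - g (z i).1) ∂(law φ (Policy.stationary f) x T)) / (N : ℝ))
      atTop (𝓝 (h x))

/-- `h*_φ`: the bias function of an (arbitrarily selected) optimal stationary policy. -/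
def optBias (φ : MDP S A lam) : S → ℝ :=
  Classical.epsilon fun h => ∃ f ∈ optimalPolicies φ, HasBias φ f h

/-- Average reward `r_φ(x, a)`. -/
def meanReward (φ : MDP S A lam) (x : S) (a : A) : ℝ :=
  ∫ r, (r : ℝ) ∂(φ.reward (x, a))

/-- Bellman operator under the action `a`. -/
def bellman (φ : MDP S A lam) (a : A) (h : S → ℝ) (x : S) : ℝ :=
  meanReward φ x a + ∑ y, (φ.trans (x, a)).real {y} * h y

/-- Optimal Bellman operator. -/
def bellmanOpt (φ : MDP S A lam) (h : S → ℝ) (x : S) : ℝ :=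
  ⨆ a : A, bellman φ a h x

/-- `O(x; φ)`: the optimal actions in state `x`. -/
def optimalActions (φ : MDP S A lam) (x : S) : Set A :=
  {a | bellmanOpt φ (optBias φ) x = bellman φ a (optBias φ) x}

/-- The gap `δ*(x, a; φ)`. -/
def gap (φ : MDP S A lam) (x : S) (a : A) : ℝ :=
  bellmanOpt φ (optBias φ) x - bellman φ a (optBias φ) x

/-! ### Confusing MDPs and the optimization problem -/

/-- `φ ≪ ψ`: absolute continuity of the kernels. -/
def AbsCont (φ ψ : MDP S A lam) : Prop :=
  ∀ z, φ.trans z ≪ ψ.trans z ∧ φ.reward z ≪ ψ.reward z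

/-- `KL_{φ|ψ}(x, a)`: divergence of the next-state laws plus divergence of the reward laws. -/
def KL (φ ψ : MDP S A lam) (x : S) (a : A) : ℝ≥0∞ :=
  InformationTheory.klDiv (φ.trans (x, a)) (ψ.trans (x, a)) +
    InformationTheory.klDiv (φ.reward (x, a)) (ψ.reward (x, a))

/-- `Δ_Φ(φ)`: the confusing MDPs. -/
def confusing (Φ : Set (MDP S A lam)) (φ : MDP S A lam) : Set (MDP S A lam) :=
  {ψ | ψ ∈ Φ ∧ AbsCont φ ψ ∧ (∀ x, ∀ a ∈ optimalActions φ x, KL φ ψ x a = 0) ∧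
    optimalPolicies φ ∩ optimalPolicies ψ = ∅}

/-- `F_Φ(φ)`: the feasible `η : S × A → [0, ∞]`, with the convention `0 * ∞ = 0`. -/
def feasible (Φ : Set (MDP S A lam)) (φ : MDP S A lam) : Set (S × A → ℝ≥0∞) :=
  {η | ∀ ψ ∈ confusing Φ φ, 1 ≤ ∑ z : S × A, η z * KL φ ψ z.1 z.2}

/-- `K_Φ(φ)`: the value of the optimization problem, in `[0, ∞]`. The gaps are nonnegative. -/
def lowerBoundConst (Φ : Set (MDP S A lam)) (φ : MDP S A lam) : ℝ≥0∞ :=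
  ⨅ η ∈ feasible Φ φ, ∑ z : S × A, η z * ENNReal.ofReal (gap φ z.1 z.2)

end StructuredMDP

end

noncomputable section

namespace StructuredMDP

set_option linter.unusedSectionVars false

variable {S A : Type*} [Fintype S] [MeasurableSpace S] [MeasurableSingletonClass S]
  [Fintype A] [MeasurableSpace A] [MeasurableSingletonClass A] {lam : Measure unitInterval}

/-! ### The joint law of the history and the current state -/

/-! The proof combines a change of measure with a compactness argument. If the liminf were below the
constant, the regret would stay under `L log T`, with `L` less than the constant, along infinitely
many `T`. The expected visit counts divided by `log T` live in the compact space `[0,∞]^(S × A)`,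
hence converge to some `η` along an ultrafilter on these times. Two facts about `η` give the
contradiction.

Cost: up to a bounded term the regret dominates the sum of gaps weighted by visits
(`exists_sum_gap_le_regret`), so `η` costs at most `L`. This rests on the average-reward optimality
equation, obtained from a maximum principle and policy improvement, and on the fact that the Cesàro
bias solves it (`exists_isOptimalPair_optBias`).

Feasibility: let `ψ` be confusing with all divergences finite. Optimality is decided state by state,
so some state `s` has no action optimal for both models (`exists_disjoint_optimalActions`). Let `E`
be the event that `φ`-optimal actions are played a linear number of times in `s`. Under `φ` it is
likely: every policy visits `s` linearly often (`exists_tendsto_count_lt`), and small regret leaves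
few suboptimal plays. Under `ψ` those actions are suboptimal, so `E` has probability at most
`T^(ε-1)`. Telling the two laws apart this well takes information about `log T`, and the information
collected is the sum of divergences weighted by visits (`integral_jointLaw_le_log`,
`eventually_log_le_sum_visits_mul_KL`).

A `ψ` with an infinite divergence is handled by adding a small constant to `η`, which costs
arbitrarily little because the gaps are finite. -/

instance isMarkovKernel_nextState (φ : MDP S A lam) (x : S) (n : ℕ) :
    IsMarkovKernel (nextState φ x n) := by
  cases n <;> (unfold nextState; infer_instance)

instance isMarkovKernel_nextObs (φ : MDP S A lam) (π : Policy S A) (x : S) (n : ℕ) :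
    IsMarkovKernel (nextObs φ π x n) := by
  unfold nextObs; infer_instance

theorem measurable_snoc (n : ℕ) :
    Measurable (fun z : (Fin n → Obs S A) × Obs S A =>
      (Fin.snoc z.1 z.2 : Fin (n + 1) → Obs S A)) := by
  refine measurable_pi_lambda _ fun i => ?_
  refine Fin.lastCases ?_ (fun j => ?_) i
  · simpa using measurable_snd
  · simp only [Fin.snoc_castSucc]
    fun_prop

instance isProbabilityMeasure_law (φ : MDP S A lam) (π : Policy S A) (x : S) (n : ℕ) :
    IsProbabilityMeasure (law φ π x n) := by
  induction n with
  | zero => unfold law; infer_instance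
  | succ n ih =>
    unfold law
    exact Measure.isProbabilityMeasure_map (measurable_snoc n).aemeasurable

/-- Joint law of the first `n` observations and of the state that follows them. -/
def jointLaw (φ : MDP S A lam) (π : Policy S A) (x : S) (n : ℕ) :
    Measure ((Fin n → Obs S A) × S) :=
  law φ π x n ⊗ₘ nextState φ x n

instance isProbabilityMeasure_jointLaw (φ : MDP S A lam) (π : Policy S A) (x : S) (n : ℕ) :
    IsProbabilityMeasure (jointLaw φ π x n) := by
  unfold jointLaw; infer_instance

theorem integrable_of_bdd {α : Type*} [MeasurableSpace α] {μ : Measure α} [IsFiniteMeasure μ]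
    {F : α → ℝ} {C : ℝ} (hF : Measurable F) (hC : ∀ z, |F z| ≤ C) : Integrable F μ :=
  Integrable.of_bound hF.aestronglyMeasurable C (ae_of_all _ hC)

theorem abs_integral_le_of_bdd {α : Type*} [MeasurableSpace α] {μ : Measure α}
    [IsProbabilityMeasure μ] {F : α → ℝ} {C : ℝ} (hC : ∀ z, |F z| ≤ C) :
    |∫ z, F z ∂μ| ≤ C := by
  simpa using norm_integral_le_of_norm_le_const (μ := μ) (f := F) (ae_of_all _ hC)

theorem integral_fst_jointLaw (φ : MDP S A lam) (π : Policy S A) (x : S) (n : ℕ)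
    {F : (Fin n → Obs S A) → ℝ} {C : ℝ} (hF : Measurable F) (hC : ∀ z, |F z| ≤ C) :
    ∫ z, F z.1 ∂(jointLaw φ π x n) = ∫ h, F h ∂(law φ π x n) := by
  have hi : Integrable (fun z : (Fin n → Obs S A) × S => F z.1) (jointLaw φ π x n) :=
    integrable_of_bdd (hF.comp measurable_fst) fun z => hC z.1
  unfold jointLaw at hi ⊢
  rw [Measure.integral_compProd hi]
  simp

theorem integral_jointLaw_zero (φ : MDP S A lam) (π : Policy S A) (x : S)
    {F : (Fin 0 → Obs S A) × S → ℝ} {C : ℝ} (hF : Measurable F) (hC : ∀ z, |F z| ≤ C) :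
    ∫ z, F z ∂(jointLaw φ π x 0) = F (fun i => i.elim0, x) := by
  unfold jointLaw
  rw [Measure.integral_compProd (integrable_of_bdd hF hC)]
  simp only [law, nextState, Kernel.const_apply]
  rw [integral_dirac, integral_dirac]

/-- Expectation of a function of the updated history and of the next state, given the history and
the current state. -/
def condExpStep (φ : MDP S A lam) (π : Policy S A) (n : ℕ) (F : (Fin (n + 1) → Obs S A) × S → ℝ)
    (z : (Fin n → Obs S A) × S) : ℝ :=
  ∫ r, ∫ y, F (Fin.snoc z.1 (z.2, π.act n z.1 z.2, r), y)
    ∂(φ.trans (z.2, π.act n z.1 z.2)) ∂(φ.reward (z.2, π.act n z.1 z.2))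

theorem measurable_act_apply (π : Policy S A) (n : ℕ) :
    Measurable (fun z : (Fin n → Obs S A) × S => (z.2, π.act n z.1 z.2)) :=
  measurable_snd.prodMk (π.measurable_act n)

theorem measurable_condExpStep (φ : MDP S A lam) (π : Policy S A) (n : ℕ)
    {F : (Fin (n + 1) → Obs S A) × S → ℝ} (hF : Measurable F) :
    Measurable (condExpStep φ π n F) := by
  unfold condExpStep
  let κ : Kernel ((Fin n → Obs S A) × S) unitInterval :=
    φ.reward.comap _ (measurable_act_apply π n)
  let η : Kernel (((Fin n → Obs S A) × S) × unitInterval) S :=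
    φ.trans.comap _ ((measurable_act_apply π n).comp measurable_fst)
  have h1 : StronglyMeasurable (fun w : (((Fin n → Obs S A) × S) × unitInterval) × S =>
      F (Fin.snoc w.1.1.1 (w.1.1.2, π.act n w.1.1.1 w.1.1.2, w.1.2), w.2)) := by
    refine (hF.comp (Measurable.prodMk ((measurable_snoc n).comp (Measurable.prodMk ?_ ?_))
      measurable_snd)).stronglyMeasurable
    · fun_prop
    · have h0 : Measurable (fun w : (((Fin n → Obs S A) × S) × unitInterval) × S => w.1.1) := by
        fun_prop
      exact (measurable_snd.comp h0).prodMk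
        (((π.measurable_act n).comp h0).prodMk (by fun_prop))
  have h2 := h1.integral_kernel_prod_right' (κ := η)
  exact (h2.integral_kernel_prod_right' (κ := κ)).measurable

theorem abs_condExpStep_le (φ : MDP S A lam) (π : Policy S A) (n : ℕ)
    {F : (Fin (n + 1) → Obs S A) × S → ℝ} {C : ℝ} (hC : ∀ z, |F z| ≤ C)
    (z : (Fin n → Obs S A) × S) : |condExpStep φ π n F z| ≤ C :=
  abs_integral_le_of_bdd fun _ => abs_integral_le_of_bdd fun _ => hC _

/-- Keeping the pending state in the joint law shifts the cut between steps: the action is then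
determined, and the only fresh randomness is the reward and the following state, both drawn from the
kernels of `φ` at one known pair. All later inductions over time go through this identity. -/
theorem integral_jointLaw_succ (φ : MDP S A lam) (π : Policy S A) (x : S) (n : ℕ)
    {F : (Fin (n + 1) → Obs S A) × S → ℝ} {C : ℝ} (hF : Measurable F) (hC : ∀ z, |F z| ≤ C) :
    ∫ z, F z ∂(jointLaw φ π x (n + 1)) = ∫ z, condExpStep φ π n F z ∂(jointLaw φ π x n) := by
  have hK : Measurable (fun h : Fin (n + 1) → Obs S A => ∫ y, F (h, y) ∂(nextState φ x (n + 1) h)) :=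
    (hF.stronglyMeasurable.integral_kernel_prod_right' (κ := nextState φ x (n + 1))).measurable
  have hKC : ∀ h, |∫ y, F (h, y) ∂(nextState φ x (n + 1) h)| ≤ C := fun h =>
    abs_integral_le_of_bdd fun _ => hC _
  unfold jointLaw
  rw [Measure.integral_compProd (integrable_of_bdd hF hC),
    Measure.integral_compProd (integrable_of_bdd (measurable_condExpStep φ π n hF)
      (abs_condExpStep_le φ π n hC)), law, integral_map (measurable_snoc n).aemeasurable
      hK.aestronglyMeasurable, Measure.integral_compProd
        (integrable_of_bdd (F := fun z : (Fin n → Obs S A) × Obs S A =>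
          ∫ y, F (Fin.snoc z.1 z.2, y) ∂(nextState φ x (n + 1) (Fin.snoc z.1 z.2)))
          (hK.comp (measurable_snoc n)) fun _ => hKC _)]
  refine integral_congr_ae (ae_of_all _ fun h => ?_)
  have hKh : Measurable (fun o : Obs S A => ∫ y, F (Fin.snoc h o, y)
      ∂(nextState φ x (n + 1) (Fin.snoc h o))) :=
    (hK.comp (measurable_snoc n)).comp measurable_prodMk_left
  simp only [nextObs]
  rw [ProbabilityTheory.integral_compProd (integrable_of_bdd hKh fun _ => hKC _)]
  refine integral_congr_ae (ae_of_all _ fun s => ?_)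
  simp only
  rw [ProbabilityTheory.integral_compProd (integrable_of_bdd (F := fun w : A × unitInterval =>
      ∫ y, F (Fin.snoc h (s, w), y) ∂(nextState φ x (n + 1) (Fin.snoc h (s, w))))
    (hKh.comp measurable_prodMk_left)
    fun _ => hKC _), Kernel.deterministic_apply, integral_dirac]
  simp [condExpStep, nextState, Kernel.comap_apply]

/-! ### Expected visits -/

/-- Probability that the `(n + 1)`-st state-action pair is `z`. -/
def occ (φ : MDP S A lam) (π : Policy S A) (x : S) (n : ℕ) (z : S × A) : ℝ :=
  (jointLaw φ π x n).real {w | (w.2, π.act n w.1 w.2) = z}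

theorem occ_nonneg (φ : MDP S A lam) (π : Policy S A) (x : S) (n : ℕ) (z : S × A) :
    0 ≤ occ φ π x n z := measureReal_nonneg

theorem exists_abs_le {ι : Type*} [Finite ι] (c : ι → ℝ) : ∃ C, ∀ i, |c i| ≤ C := by
  obtain ⟨C, hC⟩ := (Set.finite_range fun i => |c i|).bddAbove
  exact ⟨C, fun i => hC ⟨i, rfl⟩⟩

theorem integral_jointLaw_eq_sum_occ (φ : MDP S A lam) (π : Policy S A) (x : S) (n : ℕ)
    (c : S × A → ℝ) :
    ∫ w, c (w.2, π.act n w.1 w.2) ∂(jointLaw φ π x n) = ∑ z, occ φ π x n z * c z := by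
  classical
  have h : ∀ w : (Fin n → Obs S A) × S, c (w.2, π.act n w.1 w.2) =
      ∑ z, ({w | (w.2, π.act n w.1 w.2) = z} : Set ((Fin n → Obs S A) × S)).indicator
        (fun _ => c z) w := by
    intro w
    simp [Set.indicator_apply]
  have hm : ∀ z, MeasurableSet ({w | (w.2, π.act n w.1 w.2) = z} : Set ((Fin n → Obs S A) × S)) :=
    fun z => measurable_act_apply π n (measurableSet_singleton z)
  simp_rw [h]
  rw [integral_finsetSum _ fun z _ => (integrable_const _).indicator (hm z)]
  refine Finset.sum_congr rfl fun z _ => ?_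
  rw [integral_indicator_const _ (hm z)]
  simp [occ]

theorem sum_occ (φ : MDP S A lam) (π : Policy S A) (x : S) (n : ℕ) :
    ∑ z, occ φ π x n z = 1 := by
  have := integral_jointLaw_eq_sum_occ φ π x n fun _ => 1
  simpa using this.symm

/-- Expected number of visits to `z` during the first `T` steps. -/
def visits (φ : MDP S A lam) (π : Policy S A) (x : S) (T : ℕ) (z : S × A) : ℝ :=
  ∑ n ∈ Finset.range T, occ φ π x n z

theorem visits_nonneg (φ : MDP S A lam) (π : Policy S A) (x : S) (T : ℕ) (z : S × A) :
    0 ≤ visits φ π x T z := Finset.sum_nonneg fun _ _ => occ_nonneg ..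

theorem sum_visits (φ : MDP S A lam) (π : Policy S A) (x : S) (T : ℕ) :
    ∑ z, visits φ π x T z = T := by
  unfold visits
  rw [Finset.sum_comm]
  simp [sum_occ]

theorem sum_sum_occ (φ : MDP S A lam) (π : Policy S A) (x : S) (T : ℕ) (c : S × A → ℝ) :
    ∑ n ∈ Finset.range T, ∑ z, occ φ π x n z * c z = ∑ z, visits φ π x T z * c z := by
  unfold visits
  rw [Finset.sum_comm]
  simp [Finset.sum_mul]

/-- Given the past and the current pair, the reward has law `φ.reward` at that pair, so an additive
functional depends on the policy only through its expected visits. -/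
theorem integral_sum_law (φ : MDP S A lam) (π : Policy S A) (x : S) (T : ℕ)
    {c : Obs S A → ℝ} {C : ℝ} (hc : Measurable c) (hC : ∀ o, |c o| ≤ C) :
    ∫ h, ∑ i, c (h i) ∂(law φ π x T) =
      ∑ z : S × A, visits φ π x T z * ∫ r, c (z.1, z.2, r) ∂(φ.reward z) := by
  have hm : ∀ T : ℕ, Measurable fun h : Fin T → Obs S A => ∑ i, c (h i) := fun T => by fun_prop
  have hb : ∀ (T : ℕ) (h : Fin T → Obs S A), |∑ i, c (h i)| ≤ T * C := fun T h =>
    (Finset.abs_sum_le_sum_abs _ _).trans ((Finset.sum_le_sum fun i _ => hC (h i)).trans (by simp))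
  rw [← sum_sum_occ, ← integral_fst_jointLaw φ π x T (hm T) (hb T)]
  induction T with
  | zero => simp
  | succ T ih =>
    rw [integral_jointLaw_succ φ π x T (F := fun z => ∑ i, c (z.1 i)) ((hm (T + 1)).comp measurable_fst) fun z => hb _ z.1,
      Finset.sum_range_succ, ← ih]
    have hcz : ∀ w : S × A, Measurable fun r => c (w.1, w.2, r) := fun w =>
      hc.comp (by fun_prop)
    obtain ⟨D, hD⟩ := exists_abs_le fun w : S × A => ∫ r, c (w.1, w.2, r) ∂(φ.reward w)
    have h1 : Integrable (fun z : (Fin T → Obs S A) × S => ∑ i, c (z.1 i)) (jointLaw φ π x T) :=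
      integrable_of_bdd ((hm T).comp measurable_fst) fun z => hb _ z.1
    have h2 : Integrable (fun z : (Fin T → Obs S A) × S =>
        ∫ r, c (z.2, π.act T z.1 z.2, r) ∂(φ.reward (z.2, π.act T z.1 z.2))) (jointLaw φ π x T) :=
      integrable_of_bdd ((measurable_of_countable
        fun w : S × A => ∫ r, c (w.1, w.2, r) ∂(φ.reward w)).comp (measurable_act_apply π T))
        fun z => hD (z.2, π.act T z.1 z.2)
    rw [← integral_jointLaw_eq_sum_occ φ π x T, ← integral_add h1 h2]
    refine integral_congr_ae (ae_of_all _ fun z => ?_)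
    simp only [condExpStep, Fin.sum_univ_castSucc, Fin.snoc_castSucc, Fin.snoc_last,
      integral_const, probReal_univ, smul_eq_mul, one_mul]
    rw [integral_add (integrable_const _)
      (integrable_of_bdd (hcz (z.2, π.act T z.1 z.2)) fun _ => hC _)]
    simp

theorem value_eq (φ : MDP S A lam) (π : Policy S A) (T : ℕ) (x : S) :
    value φ π T x = ∑ z : S × A, visits φ π x T z * meanReward φ z.1 z.2 :=
  integral_sum_law φ π x T (c := fun o => (o.2.2 : ℝ)) (C := 1) (by fun_prop) fun o => by
    rw [abs_of_nonneg o.2.2.2.1]; exact o.2.2.2.2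

/-- Mean of `k` under the transition law of the pair `z`. -/
def transMean (φ : MDP S A lam) (k : S → ℝ) (z : S × A) : ℝ :=
  ∑ y, (φ.trans z).real {y} * k y

theorem integral_trans (φ : MDP S A lam) (k : S → ℝ) (z : S × A) :
    ∫ y, k y ∂(φ.trans z) = transMean φ k z := by
  rw [integral_fintype]
  · rfl
  · obtain ⟨C, hC⟩ := exists_abs_le k
    exact integrable_of_bdd (measurable_of_countable k) hC

/-- Expectation of `k` at the state that follows `n` steps. -/
def stateMean (φ : MDP S A lam) (π : Policy S A) (x : S) (k : S → ℝ) (n : ℕ) : ℝ :=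
  ∫ w, k w.2 ∂(jointLaw φ π x n)

theorem abs_stateMean_le (φ : MDP S A lam) (π : Policy S A) (x : S) {k : S → ℝ} {C : ℝ}
    (hC : ∀ s, |k s| ≤ C) (n : ℕ) : |stateMean φ π x k n| ≤ C :=
  abs_integral_le_of_bdd fun w => hC w.2

theorem stateMean_zero (φ : MDP S A lam) (π : Policy S A) (x : S) (k : S → ℝ) :
    stateMean φ π x k 0 = k x := by
  obtain ⟨C, hC⟩ := exists_abs_le k
  exact integral_jointLaw_zero φ π x ((measurable_of_countable k).comp measurable_snd)
    fun z => hC z.2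

theorem stateMean_eq (φ : MDP S A lam) (π : Policy S A) (x : S) (k : S → ℝ) (n : ℕ) :
    stateMean φ π x k n = ∑ z : S × A, occ φ π x n z * k z.1 :=
  integral_jointLaw_eq_sum_occ φ π x n fun z => k z.1

theorem stateMean_succ (φ : MDP S A lam) (π : Policy S A) (x : S) (k : S → ℝ) (n : ℕ) :
    stateMean φ π x k (n + 1) = ∑ z : S × A, occ φ π x n z * transMean φ k z := by
  obtain ⟨C, hC⟩ := exists_abs_le k
  unfold stateMean
  rw [integral_jointLaw_succ φ π x n (F := fun z => k z.2) ((measurable_of_countable k).comp measurable_snd)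
    (fun z => hC z.2), ← integral_jointLaw_eq_sum_occ φ π x n]
  refine integral_congr_ae (ae_of_all _ fun z => ?_)
  simp [condExpStep, integral_trans]

/-- A telescoping sum: the transition means at step `n` average to the expectation of `k` one step
later. -/
theorem sum_visits_transMean_sub (φ : MDP S A lam) (π : Policy S A) (x : S) (k : S → ℝ) (T : ℕ) :
    ∑ z : S × A, visits φ π x T z * (transMean φ k z - k z.1) = stateMean φ π x k T - k x := by
  rw [← sum_sum_occ, ← stateMean_zero φ π x k, ← Finset.sum_range_sub (stateMean φ π x k) T]
  refine Finset.sum_congr rfl fun n _ => ?_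
  rw [stateMean_succ, stateMean_eq, ← Finset.sum_sub_distrib]
  simp_rw [mul_sub]

/-! ### Change of measure -/

open InformationTheory in
/-- Donsker-Varadhan inequality. -/
theorem integral_le_klDiv_add_log {α : Type*} [MeasurableSpace α] {μ ν : Measure α}
    [IsProbabilityMeasure μ] [IsProbabilityMeasure ν] (h : klDiv μ ν ≠ ∞) {F : α → ℝ} {C : ℝ}
    (hF : Measurable F) (hC : ∀ z, |F z| ≤ C) :
    ∫ z, F z ∂μ ≤ (klDiv μ ν).toReal + Real.log (∫ z, Real.exp (F z) ∂ν) := by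
  obtain ⟨hac, hint⟩ := klDiv_ne_top_iff.1 h
  have hFμ : Integrable F μ := integrable_of_bdd hF hC
  have hFν : Integrable (fun z => Real.exp (F z)) ν :=
    integrable_of_bdd (C := Real.exp C) hF.exp fun z => by
      rw [abs_of_pos (Real.exp_pos _)]
      exact Real.exp_le_exp.2 (le_of_abs_le (hC z))
  -- The inequality is the nonnegativity of the divergence of `μ` from `ν` tilted by `F`.
  have hac' : μ ≪ ν.tilted F := hac.trans (absolutelyContinuous_tilted hFν)
  have : IsProbabilityMeasure (ν.tilted F) := isProbabilityMeasure_tilted hFν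
  have h0 := integral_llr_add_sub_measure_univ_nonneg hac'
    (integrable_llr_tilted_right hac hFμ hint hFν)
  rw [integral_llr_tilted_right hac hFμ hFν hint] at h0
  rw [toReal_klDiv_of_measure_eq hac (by simp)]
  simp only [probReal_univ] at h0
  linarith

theorem exp_mem_Icc_of_abs_le {a C : ℝ} (h : |a| ≤ C) :
    Real.exp a ∈ Set.Icc (Real.exp (-C)) (Real.exp C) :=
  ⟨Real.exp_le_exp.2 (neg_le_of_abs_le h), Real.exp_le_exp.2 (le_of_abs_le h)⟩

theorem abs_log_le_of_mem_Icc {a C : ℝ} (h : a ∈ Set.Icc (Real.exp (-C)) (Real.exp C)) :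
    |Real.log a| ≤ C := by
  have ha : 0 < a := (Real.exp_pos _).trans_le h.1
  rw [abs_le]
  exact ⟨(Real.le_log_iff_exp_le ha).2 h.1, (Real.log_le_iff_le_exp ha).2 h.2⟩

theorem integral_mem_Icc {α : Type*} [MeasurableSpace α] {μ : Measure α} [IsProbabilityMeasure μ]
    {F : α → ℝ} {a b : ℝ} (hF : Measurable F) (h : ∀ z, F z ∈ Set.Icc a b) :
    ∫ z, F z ∂μ ∈ Set.Icc a b := by
  have hi : Integrable F μ := integrable_of_bdd (C := max |a| |b|) hF fun z =>
    abs_le_max_abs_abs (h z).1 (h z).2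
  constructor
  · simpa using integral_mono (integrable_const a) hi fun z => (h z).1
  · simpa using integral_mono hi (integrable_const b) fun z => (h z).2

open InformationTheory in
-- Donsker-Varadhan is applied to the inner variable for each fixed `a`, then to the outer variable
-- with the resulting log-moment as test function. The exponential undoes the logarithm, so the two
-- bounds chain without any product-measure divergence.
theorem integral_integral_le_klDiv_add_log {α β : Type*} [MeasurableSpace α] [MeasurableSpace β]
    {μ μ' : Measure α} {ν ν' : Measure β} [IsProbabilityMeasure μ] [IsProbabilityMeasure μ']
    [IsProbabilityMeasure ν] [IsProbabilityMeasure ν'] (hμ : klDiv μ μ' ≠ ∞) (hν : klDiv ν ν' ≠ ∞)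
    {F : α × β → ℝ} {C : ℝ} (hF : Measurable F) (hC : ∀ z, |F z| ≤ C) :
    ∫ a, ∫ b, F (a, b) ∂ν ∂μ ≤ (klDiv ν ν' + klDiv μ μ').toReal +
      Real.log (∫ a, ∫ b, Real.exp (F (a, b)) ∂ν' ∂μ') := by
  have hs : ∀ a, Measurable fun b => F (a, b) := fun a => hF.comp measurable_prodMk_left
  have hm : Measurable fun a => ∫ b, F (a, b) ∂ν :=
    hF.stronglyMeasurable.integral_prod_right'.measurable
  have hme : Measurable fun a => ∫ b, Real.exp (F (a, b)) ∂ν' :=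
    hF.exp.stronglyMeasurable.integral_prod_right'.measurable
  have hbe : ∀ a, ∫ b, Real.exp (F (a, b)) ∂ν' ∈ Set.Icc (Real.exp (-C)) (Real.exp C) :=
    fun a => integral_mem_Icc (hs a).exp fun b => exp_mem_Icc_of_abs_le (hC _)
  have hbl := fun a => abs_log_le_of_mem_Icc (hbe a)
  have hil : Integrable (fun a => Real.log (∫ b, Real.exp (F (a, b)) ∂ν')) μ :=
    integrable_of_bdd hme.log hbl
  have h1 : ∫ a, ∫ b, F (a, b) ∂ν ∂μ ≤
      ∫ a, ((klDiv ν ν').toReal + Real.log (∫ b, Real.exp (F (a, b)) ∂ν')) ∂μ :=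
    integral_mono (integrable_of_bdd hm fun a => abs_integral_le_of_bdd fun b => hC _)
      ((integrable_const _).add hil)
      fun a => integral_le_klDiv_add_log hν (hs a) fun b => hC _
  rw [integral_add (integrable_const _) hil] at h1
  have h2 := integral_le_klDiv_add_log hμ hme.log hbl
  simp only [Real.exp_log ((Real.exp_pos (-C)).trans_le (hbe _).1)] at h2
  rw [ENNReal.toReal_add hν hμ]
  simp only [integral_const, probReal_univ, smul_eq_mul, one_mul] at h1
  linarith

/-- A Donsker-Varadhan inequality for whole trajectories. Both models share the policy, so each step
only costs the divergence at the pair played. The variational form replaces likelihood ratios and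
their concentration. -/
theorem integral_jointLaw_le_log (φ ψ : MDP S A lam) (hKL : ∀ z : S × A, KL φ ψ z.1 z.2 ≠ ∞)
    (π : Policy S A) (x : S) (n : ℕ) {F : (Fin n → Obs S A) × S → ℝ} {C : ℝ}
    (hF : Measurable F) (hC : ∀ z, |F z| ≤ C) :
    ∫ z, F z ∂(jointLaw φ π x n) ≤ ∑ z : S × A, visits φ π x n z * (KL φ ψ z.1 z.2).toReal +
      Real.log (∫ z, Real.exp (F z) ∂(jointLaw ψ π x n)) := by
  induction n generalizing C with
  | zero =>
    rw [integral_jointLaw_zero φ π x hF hC, integral_jointLaw_zero ψ π x (C := Real.exp C) hF.exp]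
    · simp [visits]
    · intro z
      rw [abs_of_pos (Real.exp_pos _)]
      exact (exp_mem_Icc_of_abs_le (hC z)).2
  | succ n ih =>
    have hbe : ∀ z, |Real.exp (F z)| ≤ Real.exp C := fun z => by
      rw [abs_of_pos (Real.exp_pos _)]
      exact (exp_mem_Icc_of_abs_le (hC z)).2
    have hslice : ∀ z : (Fin n → Obs S A) × S, Measurable fun w : unitInterval × S =>
        F (Fin.snoc z.1 (z.2, π.act n z.1 z.2, w.1), w.2) := fun z =>
      hF.comp (((measurable_snoc n).comp (by fun_prop : Measurable fun w : unitInterval × S =>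
        (z.1, ((z.2, π.act n z.1 z.2, w.1) : Obs S A)))).prodMk measurable_snd)
    have hm := measurable_condExpStep ψ π n hF.exp
    have hb : ∀ z, condExpStep ψ π n (fun z => Real.exp (F z)) z ∈
        Set.Icc (Real.exp (-C)) (Real.exp C) := fun z =>
      integral_mem_Icc ((hslice z).exp.stronglyMeasurable.integral_prod_right'.measurable)
        fun r => integral_mem_Icc (measurable_of_countable _)
          fun y => exp_mem_Icc_of_abs_le (hC _)
    have hbl := fun z => abs_log_le_of_mem_Icc (hb z)
    have hstep : ∀ z : (Fin n → Obs S A) × S, condExpStep φ π n F z ≤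
        (KL φ ψ z.2 (π.act n z.1 z.2)).toReal +
          Real.log (condExpStep ψ π n (fun z => Real.exp (F z)) z) := by
      intro z
      have h := hKL (z.2, π.act n z.1 z.2)
      simp only [KL, ne_eq, ENNReal.add_eq_top, not_or] at h
      exact integral_integral_le_klDiv_add_log h.2 h.1 (hslice z) fun w => hC _
    have hic : Integrable (fun z : (Fin n → Obs S A) × S =>
        (KL φ ψ z.2 (π.act n z.1 z.2)).toReal) (jointLaw φ π x n) := by
      obtain ⟨D, hD⟩ := exists_abs_le fun z : S × A => (KL φ ψ z.1 z.2).toReal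
      exact integrable_of_bdd ((measurable_of_countable
        fun z : S × A => (KL φ ψ z.1 z.2).toReal).comp (measurable_act_apply π n))
        fun z => hD (z.2, π.act n z.1 z.2)
    have hil := integrable_of_bdd (μ := jointLaw φ π x n) hm.log hbl
    have h1 := integral_mono (integrable_of_bdd (μ := jointLaw φ π x n)
      (measurable_condExpStep φ π n hF) (abs_condExpStep_le φ π n hC)) (hic.add hil) hstep
    -- The induction runs on the log of the one-step exponential moment under `ψ`; exponentiating it
    -- gives back the integrand of step `n + 1`.
    have h2 := ih hm.log hbl
    simp only [Real.exp_log ((Real.exp_pos (-C)).trans_le (hb _).1)] at h2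
    have h3 := integral_jointLaw_eq_sum_occ φ π x n fun z => (KL φ ψ z.1 z.2).toReal
    simp only [Pi.add_apply] at h1
    rw [integral_add hic hil, h3] at h1
    rw [integral_jointLaw_succ φ π x n hF hC, integral_jointLaw_succ ψ π x n hF.exp hbe,
      ← sum_sum_occ, Finset.sum_range_succ, sum_sum_occ]
    linarith

/-! ### Finite irreducible chains -/

section Chain

variable {ι α : Type*} [Fintype ι]

/-- A finite stochastic matrix without nontrivial closed sets. -/
structure IsIrreducibleChain (P : ι → ι → ℝ) : Prop where
  nonneg : ∀ i j, 0 ≤ P i j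
  sum_eq_one : ∀ i, ∑ j, P i j = 1
  eq_univ_of_closed : ∀ D : Set ι, D.Nonempty → (∀ i ∈ D, ∀ j, 0 < P i j → j ∈ D) → D = Set.univ

/-- Maximum principle: subharmonic functions are constant. -/
theorem IsIrreducibleChain.eq_of_le {P : ι → ι → ℝ} (hP : IsIrreducibleChain P) {u : ι → ℝ}
    (hu : ∀ i, u i ≤ ∑ j, P i j * u j) (i j : ι) : u i = u j := by
  have : Nonempty ι := ⟨i⟩
  obtain ⟨m, hm⟩ := Finite.exists_max u
  have key : {i | u i = u m} = Set.univ := by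
    refine hP.eq_univ_of_closed _ ⟨m, rfl⟩ fun i hi j hij => ?_
    by_contra hne
    have hlt : u j < u m := lt_of_le_of_ne (hm j) hne
    have h1 : ∑ k, P i k * u k < ∑ k, P i k * u m :=
      Finset.sum_lt_sum (fun k _ => mul_le_mul_of_nonneg_left (hm k) (hP.nonneg i k))
        ⟨j, Finset.mem_univ j, mul_lt_mul_of_pos_left hlt hij⟩
    rw [← Finset.sum_mul, hP.sum_eq_one, one_mul] at h1
    have h2 := hu i
    change u i = u m at hi
    linarith
  have hi : i ∈ {i | u i = u m} := key ▸ Set.mem_univ i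
  have hj : j ∈ {i | u i = u m} := key ▸ Set.mem_univ j
  exact hi.trans hj.symm

theorem IsIrreducibleChain.eq_of_ge {P : ι → ι → ℝ} (hP : IsIrreducibleChain P) {u : ι → ℝ}
    (hu : ∀ i, ∑ j, P i j * u j ≤ u i) (i j : ι) : u i = u j := by
  have := hP.eq_of_le (u := fun i => -u i) (fun i => by simpa using hu i) i j
  simpa using this

theorem IsIrreducibleChain.sum_mul_eq {P : ι → ι → ℝ} (hP : IsIrreducibleChain P) {u : ι → ℝ}
    (hu : ∀ i j, u i = u j) (i : ι) : ∑ j, P i j * u j = u i := by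
  simp_rw [fun j => hu j i]
  rw [← Finset.sum_mul, hP.sum_eq_one, one_mul]

/-- The Poisson equation of an irreducible chain is solvable. -/
theorem IsIrreducibleChain.exists_poisson [Nonempty ι] {P : ι → ι → ℝ}
    (hP : IsIrreducibleChain P) (r : ι → ℝ) :
    ∃ (g : ℝ) (h : ι → ℝ), ∀ i, g + h i = r i + ∑ j, P i j * h j := by
  classical
  obtain ⟨o⟩ := ‹Nonempty ι›
  -- The bias is only defined up to a constant, so it is normalised to vanish at `o`, and the freed
  -- coordinate stores the gain. This makes the system square, and injectivity suffices.
  let L : (ι → ℝ) →ₗ[ℝ] (ι → ℝ) :=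
    { toFun := fun v i => v o + (Function.update v o 0 i - ∑ j, P i j * Function.update v o 0 j)
      map_add' := fun v w => by
        ext i
        have : Function.update (v + w) o 0 = Function.update v o 0 + Function.update w o 0 := by
          rw [← Function.update_add]; simp
        simp only [this, Pi.add_apply, mul_add, Finset.sum_add_distrib]
        ring
      map_smul' := fun c v => by
        ext i
        have : Function.update (c • v) o 0 = c • Function.update v o 0 := by
          rw [← Function.update_smul]; simp
        simp only [this, Pi.smul_apply, smul_eq_mul, RingHom.id_apply, mul_sub, mul_add,
          Finset.mul_sum]
        congr 3
        funext j
        ring }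
  have hL : Function.Injective L := by
    rw [injective_iff_map_eq_zero]
    intro v hv
    have hvi : ∀ i, v o + (Function.update v o 0 i - ∑ j, P i j * Function.update v o 0 j) = 0 :=
      fun i => congrFun hv i
    have hc : ∀ i j, Function.update v o 0 i = Function.update v o 0 j := by
      -- According to the sign of the gain, the normalised function is sub- or superharmonic, hence
      -- constant in both cases.
      rcases le_total 0 (v o) with h0 | h0
      · exact hP.eq_of_le fun i => by linarith [hvi i]
      · exact hP.eq_of_ge fun i => by linarith [hvi i]
    have h0 : v o = 0 := by
      have := hvi o
      rw [hP.sum_mul_eq hc] at this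
      linarith
    ext i
    by_cases hi : i = o
    · rw [hi]; exact h0
    · have := hc i o
      simpa [hi] using this
  obtain ⟨v, hv⟩ := LinearMap.injective_iff_surjective.1 hL r
  refine ⟨v o, Function.update v o 0, fun i => ?_⟩
  have hvi : v o + (Function.update v o 0 i - ∑ j, P i j * Function.update v o 0 j) = r i :=
    congrFun hv i
  linarith

/-- If a stationary policy has maximal gain, its bias solves the optimality equation. -/
theorem bellman_le_of_forall_gain_le {p : ι → α → ι → ℝ}
    (hp : ∀ f : ι → α, IsIrreducibleChain fun i j => p i (f i) j) (r : ι → α → ℝ)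
    {f : ι → α} {g : ℝ} {h : ι → ℝ} (hf : ∀ i, g + h i = r i (f i) + ∑ j, p i (f i) j * h j)
    (hmax : ∀ (f' : ι → α) (g' : ℝ) (h' : ι → ℝ),
      (∀ i, g' + h' i = r i (f' i) + ∑ j, p i (f' i) j * h' j) → g' ≤ g) (i : ι) (a : α) :
    r i a + ∑ j, p i a j * h j ≤ g + h i := by
  classical
  by_contra! hlt
  have : Nonempty ι := ⟨i⟩
  -- Policy improvement: changing `f` only at `i` cannot raise the gain, so `h' - h` is
  -- superharmonic for the new chain, hence constant; this contradicts the strict inequality at `i`.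
  let f' := Function.update f i a
  obtain ⟨g', h', hf'⟩ := (hp f').exists_poisson fun i => r i (f' i)
  have hg := hmax f' g' h' hf'
  have hge : ∀ k, g + h k ≤ r k (f' k) + ∑ j, p k (f' k) j * h j := by
    intro k
    by_cases hk : k = i
    · subst hk; simp only [f', Function.update_self]; exact hlt.le
    · simp only [f', Function.update_of_ne hk]; exact (hf k).le
  have hsub : ∀ k, ∑ j, p k (f' k) j * (h' j - h j) =
      ∑ j, p k (f' k) j * h' j - ∑ j, p k (f' k) j * h j := fun k => by
    simp_rw [mul_sub, Finset.sum_sub_distrib]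
  have hc := (hp f').eq_of_ge (u := fun k => h' k - h k) fun k => by
    rw [hsub]; linarith [hge k, hf' k]
  have h1 := (hp f').sum_mul_eq hc i
  rw [hsub] at h1
  have h2 := hf' i
  simp only [f', Function.update_self] at h1 h2
  linarith

/-- The average-reward optimality equation of a finite irreducible decision process. -/
theorem exists_optimality_equation [Nonempty ι] [Finite α] [Nonempty α] {p : ι → α → ι → ℝ}
    (hp : ∀ f : ι → α, IsIrreducibleChain fun i j => p i (f i) j) (r : ι → α → ℝ) :
    ∃ (g : ℝ) (h : ι → ℝ) (f : ι → α), (∀ i a, r i a + ∑ j, p i a j * h j ≤ g + h i) ∧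
      ∀ i, g + h i = r i (f i) + ∑ j, p i (f i) j * h j := by
  classical
  choose G H hGH using fun f : ι → α => (hp f).exists_poisson fun i => r i (f i)
  obtain ⟨f, hf⟩ := Finite.exists_max G
  refine ⟨G f, H f, f, fun i a => bellman_le_of_forall_gain_le hp r (hGH f)
    (fun f' g' h' hg' => ?_) i a, hGH f⟩
  -- The gain in the Poisson equation is unique: the difference of two solutions is sub- or
  -- superharmonic, depending on which gain is larger.
  suffices g' = G f' by rw [this]; exact hf f'
  have hsub : ∀ k, ∑ j, p k (f' k) j * (h' j - H f' j) =
      ∑ j, p k (f' k) j * h' j - ∑ j, p k (f' k) j * H f' j := fun k => by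
    simp_rw [mul_sub, Finset.sum_sub_distrib]
  have hc : ∀ i j, h' i - H f' i = h' j - H f' j := by
    rcases le_total g' (G f') with h0 | h0
    · exact (hp f').eq_of_ge (u := fun k => h' k - H f' k) fun k => by
        rw [hsub]; linarith [hg' k, hGH f' k]
    · exact (hp f').eq_of_le (u := fun k => h' k - H f' k) fun k => by
        rw [hsub]; linarith [hg' k, hGH f' k]
  have h1 := (hp f').sum_mul_eq (u := fun k => h' k - H f' k) hc i
  rw [hsub] at h1
  linarith [hg' i, hGH f' i]

end Chain

/-! ### Ergodicity -/

theorem isIrreducibleChain_of_isErgodic {φ : MDP S A lam} (hφ : IsErgodic φ) (f : S → A) :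
    IsIrreducibleChain fun i j => (φ.trans (i, f i)).real {j} where
  nonneg _ _ := measureReal_nonneg
  sum_eq_one i := by simp
  eq_univ_of_closed D hD hcl := by
    obtain ⟨i, hi⟩ := hD
    refine Set.eq_univ_of_forall fun j => ?_
    let := Matrix.toQuiver (Matrix.of fun x y => (φ.trans (x, f x)).real {y})
    obtain ⟨q, -⟩ := (hφ f).connected i j
    induction q with
    | nil => exact hi
    | cons q e ih => exact hcl _ ih _ e.down

theorem isIrreducible_of_forall_pos_imp {ι : Type*} {M N : Matrix ι ι ℝ} (hM : M.IsIrreducible)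
    (hN : ∀ i j, 0 ≤ N i j) (hMN : ∀ i j, 0 < M i j → 0 < N i j) : N.IsIrreducible := by
  refine ⟨hN, fun i j => ?_⟩
  have key : ∀ k (q : @Quiver.Path ι M.toQuiver i k),
      ∃ q' : @Quiver.Path ι N.toQuiver i k,
        @Quiver.Path.length ι N.toQuiver i k q' = @Quiver.Path.length ι M.toQuiver i k q := by
    intro k q
    induction q with
    | nil => exact ⟨@Quiver.Path.nil ι N.toQuiver i, rfl⟩
    | cons q e ih =>
      obtain ⟨q', hq'⟩ := ih
      refine ⟨@Quiver.Path.cons ι N.toQuiver i _ _ q' ⟨hMN _ _ e.down⟩, ?_⟩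
      rw [@Quiver.Path.length_cons, @Quiver.Path.length_cons, hq']
  obtain ⟨q, hq⟩ := hM.connected i j
  obtain ⟨q', hq'⟩ := key j q
  exact ⟨q', by rw [hq']; exact hq⟩

/-- Absolute continuity keeps every transition of `φ` possible under `ψ`. This is what makes uniform
goodness applicable to a confusing model. -/
theorem IsErgodic.of_absCont {φ ψ : MDP S A lam} (hφ : IsErgodic φ) (h : AbsCont φ ψ) :
    IsErgodic ψ := fun f =>
  isIrreducible_of_forall_pos_imp (hφ f) (fun _ _ => measureReal_nonneg) fun i j hij => by
    simp only [Matrix.of_apply, measureReal_def, ENNReal.toReal_pos_iff] at hij ⊢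
    refine ⟨pos_iff_ne_zero.2 fun h0 => hij.1.ne' ((h (i, f i)).1 h0), measure_lt_top _ _⟩

/-! ### Gain and bias -/

/-- `g` and `h` satisfy the evaluation equation of the stationary policy `f`. -/
def IsPoisson (φ : MDP S A lam) (f : S → A) (g : ℝ) (h : S → ℝ) : Prop :=
  ∀ s, g + h s = bellman φ (f s) h s

/-- `g` and `h` satisfy the average-reward optimality equation. -/
def IsOptimalPair (φ : MDP S A lam) (g : ℝ) (h : S → ℝ) : Prop :=
  (∀ s a, bellman φ a h s ≤ g + h s) ∧ ∀ s, ∃ a, g + h s = bellman φ a h s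

theorem exists_isPoisson [Nonempty S] {φ : MDP S A lam} (hφ : IsErgodic φ) (f : S → A) :
    ∃ g h, IsPoisson φ f g h :=
  (isIrreducibleChain_of_isErgodic hφ f).exists_poisson fun s => meanReward φ s (f s)

/-- An identity for arbitrary `g` and `h`. The last sum vanishes when a stationary policy satisfies
its Poisson equation and is nonnegative for an optimal pair, which gives gains, upper bounds on
gains, and the regret decomposition. -/
theorem value_eq_of_pair (φ : MDP S A lam) (π : Policy S A) (x : S) (T : ℕ) (g : ℝ) (h : S → ℝ) :
    value φ π T x = T * g + h x - stateMean φ π x h T -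
      ∑ z : S × A, visits φ π x T z * (g + h z.1 - bellman φ z.2 h z.1) := by
  have h1 := sum_visits_transMean_sub φ π x h T
  have h2 := sum_visits φ π x T
  have h3 := value_eq φ π T x
  have h4 : ∑ z : S × A, visits φ π x T z * (g + h z.1 - bellman φ z.2 h z.1) =
      (∑ z, visits φ π x T z) * g - (∑ z : S × A, visits φ π x T z * meanReward φ z.1 z.2) -
        ∑ z : S × A, visits φ π x T z * (transMean φ h z - h z.1) := by
    rw [Finset.sum_mul, ← Finset.sum_sub_distrib, ← Finset.sum_sub_distrib]
    refine Finset.sum_congr rfl fun z _ => ?_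
    simp only [bellman, transMean]
    ring
  rw [h4, h1, h2, ← h3]
  ring

theorem sum_occ_stationary_eq_zero (φ : MDP S A lam) (f : S → A) (x : S) (n : ℕ) {c : S × A → ℝ}
    (hc : ∀ s, c (s, f s) = 0) : ∑ z, occ φ (Policy.stationary f) x n z * c z = 0 := by
  rw [← integral_jointLaw_eq_sum_occ]
  simp [Policy.stationary, hc]

theorem value_stationary (φ : MDP S A lam) {f : S → A} {g : ℝ} {h : S → ℝ}
    (hf : IsPoisson φ f g h) (x : S) (T : ℕ) :
    value φ (Policy.stationary f) T x = T * g + h x - stateMean φ (Policy.stationary f) x h T := by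
  rw [value_eq_of_pair φ _ x T g h, ← sum_sum_occ, Finset.sum_eq_zero, sub_zero]
  exact fun n _ => sum_occ_stationary_eq_zero φ f x n fun s => by
    simp only; linarith [hf s]

theorem hasGain_stationary (φ : MDP S A lam) {f : S → A} {g : ℝ} {h : S → ℝ}
    (hf : IsPoisson φ f g h) (x : S) : HasGain φ (Policy.stationary f) x g := by
  obtain ⟨C, hC⟩ := exists_abs_le h
  have h0 : Tendsto (fun T : ℕ => (h x - stateMean φ (Policy.stationary f) x h T) / T) atTop
      (𝓝 0) := by
    refine tendsto_of_tendsto_of_tendsto_of_le_of_le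
      (tendsto_const_div_atTop_nhds_zero_nat (-(2 * C)))
      (tendsto_const_div_atTop_nhds_zero_nat (2 * C)) (fun T => ?_) fun T => ?_
    all_goals
      have h1 := abs_le.1 (hC x)
      have h2 := abs_le.1 (abs_stateMean_le φ (Policy.stationary f) x hC T)
      refine div_le_div_of_nonneg_right ?_ T.cast_nonneg
      linarith
  have h1 : Tendsto (fun T : ℕ => g + (h x - stateMean φ (Policy.stationary f) x h T) / T) atTop
      (𝓝 g) := by simpa using h0.const_add g
  refine h1.congr' ?_
  filter_upwards [eventually_ne_atTop 0] with T hT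
  have : (T : ℝ) ≠ 0 := Nat.cast_ne_zero.2 hT
  rw [value_stationary φ hf]
  field_simp
  ring

theorem gain_le_of_isOptimalPair {φ : MDP S A lam} {g : ℝ} {h : S → ℝ}
    (hgh : IsOptimalPair φ g h) {π : Policy S A} {x : S} {g' : ℝ} (hg' : HasGain φ π x g') :
    g' ≤ g := by
  obtain ⟨C, hC⟩ := exists_abs_le h
  have h0 : Tendsto (fun T : ℕ => g + 2 * C / T) atTop (𝓝 g) := by
    simpa using (tendsto_const_div_atTop_nhds_zero_nat (2 * C)).const_add g
  refine le_of_tendsto_of_tendsto hg' h0 ?_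
  filter_upwards [eventually_gt_atTop 0] with T hT
  have hT' : (0 : ℝ) < T := Nat.cast_pos.2 hT
  have h1 : 0 ≤ ∑ z : S × A, visits φ π x T z * (g + h z.1 - bellman φ z.2 h z.1) :=
    Finset.sum_nonneg fun z _ => mul_nonneg (visits_nonneg ..) (by linarith [hgh.1 z.1 z.2])
  rw [value_eq_of_pair φ π x T g h, div_le_iff₀ hT', add_mul, div_mul_cancel₀ _ hT'.ne']
  have h2 := abs_le.1 (abs_stateMean_le φ π x hC T)
  have h3 := abs_le.1 (hC x)
  linarith

theorem mem_optimalPolicies_of_isPoisson {φ : MDP S A lam} {g : ℝ} {h : S → ℝ}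
    (hgh : IsOptimalPair φ g h) {f : S → A} (hf : IsPoisson φ f g h) : f ∈ optimalPolicies φ :=
  fun x => ⟨g, hasGain_stationary φ hf x, fun _ _ hg' => gain_le_of_isOptimalPair hgh hg'⟩

theorem gain_eq_of_mem_optimalPolicies {φ : MDP S A lam} {g : ℝ} {h : S → ℝ} {f : S → A} (x : S)
    (hf : IsPoisson φ f g h) (hopt : f ∈ optimalPolicies φ) {π : Policy S A} {g' : ℝ}
    (hg' : HasGain φ π x g') : g' ≤ g := by
  obtain ⟨g₀, hg₀, hmax⟩ := hopt x
  rw [tendsto_nhds_unique (hasGain_stationary φ hf x) hg₀]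
  exact hmax π g' hg'

theorem isOptimalPair_of_mem_optimalPolicies [Nonempty S] {φ : MDP S A lam} (hφ : IsErgodic φ)
    {g : ℝ} {h : S → ℝ} {f : S → A} (hf : IsPoisson φ f g h) (hopt : f ∈ optimalPolicies φ) :
    IsOptimalPair φ g h := by
  refine ⟨fun s a => ?_, fun s => ⟨f s, hf s⟩⟩
  exact bellman_le_of_forall_gain_le (p := fun i a j => (φ.trans (i, a)).real {j})
    (isIrreducibleChain_of_isErgodic hφ) (meanReward φ) hf (fun f' g' h' hf' =>
      gain_eq_of_mem_optimalPolicies (Classical.arbitrary S) hf hopt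
        (hasGain_stationary φ (f := f') (h := h') hf' _)) s a

theorem exists_isOptimalPair [Nonempty S] [Nonempty A] {φ : MDP S A lam} (hφ : IsErgodic φ) :
    ∃ g h f, IsOptimalPair φ g h ∧ IsPoisson φ f g h := by
  obtain ⟨g, h, f, h1, h2⟩ := exists_optimality_equation
    (p := fun i a j => (φ.trans (i, a)).real {j}) (isIrreducibleChain_of_isErgodic hφ)
    (meanReward φ)
  exact ⟨g, h, f, ⟨h1, fun s => ⟨f s, h2 s⟩⟩, h2⟩

/-- A second Poisson equation, with `h` as reward, turns the Cesàro sum of `stateMean` of `h` into a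
telescoping one. No aperiodicity is needed, and the bias differs from `h` only by a constant. -/
theorem exists_tendsto_bias [Nonempty S] {φ : MDP S A lam} (hφ : IsErgodic φ) {f : S → A} {g : ℝ}
    {h : S → ℝ} (hf : IsPoisson φ f g h) : ∃ c : ℝ, ∀ x, Tendsto (fun N : ℕ =>
      (∑ T ∈ Finset.Icc 1 N, ∫ z, ∑ i, (((z i).2.2 : ℝ) - g)
        ∂(law φ (Policy.stationary f) x T)) / (N : ℝ)) atTop (𝓝 (h x - c)) := by
  obtain ⟨c, w, hw⟩ := (isIrreducibleChain_of_isErgodic hφ f).exists_poisson h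
  refine ⟨c, fun x => ?_⟩
  set π := Policy.stationary f
  have hstep : ∀ n, stateMean φ π x h n = c + stateMean φ π x w n - stateMean φ π x w (n + 1) := by
    intro n
    have h0 := sum_occ_stationary_eq_zero φ f x n
      (c := fun z => c + w z.1 - transMean φ w z - h z.1) fun s => by
        simp only [transMean]; linarith [hw s]
    simp only [mul_sub, mul_add, Finset.sum_sub_distrib, Finset.sum_add_distrib,
      ← Finset.sum_mul, sum_occ, one_mul] at h0
    rw [stateMean_succ, stateMean_eq, stateMean_eq]
    linarith
  have hint : ∀ T : ℕ, ∫ z, ∑ i, (((z i).2.2 : ℝ) - g) ∂(law φ π x T) =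
      h x - stateMean φ π x h T := by
    intro T
    rw [integral_sum_law φ π x T (c := fun o => (o.2.2 : ℝ) - g) (C := 1 + |g|) (by fun_prop)
      fun o => (abs_sub _ _).trans (by
        gcongr; rw [abs_of_nonneg o.2.2.2.1]; exact o.2.2.2.2)]
    have hr : ∀ z : S × A, ∫ r : unitInterval, ((r : ℝ) - g) ∂(φ.reward z) =
        meanReward φ z.1 z.2 - g := fun z => by
      rw [integral_sub]
      · simp [meanReward]
      · exact integrable_of_bdd (C := 1) (by fun_prop) fun r => by
          rw [abs_of_nonneg r.2.1]; exact r.2.2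
      · exact integrable_const _
    simp only [hr, mul_sub, Finset.sum_sub_distrib, ← Finset.sum_mul, sum_visits]
    rw [← value_eq, value_stationary φ hf]
    ring
  have hsum : ∀ N : ℕ, ∑ T ∈ Finset.Icc 1 N, ∫ z, ∑ i, (((z i).2.2 : ℝ) - g) ∂(law φ π x T) =
      N * (h x - c) + (stateMean φ π x w (N + 1) - stateMean φ π x w 1) := by
    intro N
    induction N with
    | zero => simp
    | succ N ih =>
      rw [Finset.sum_Icc_succ_top (by omega), ih, hint, hstep]
      push_cast
      ring
  obtain ⟨C, hC⟩ := exists_abs_le w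
  have h0 : Tendsto (fun N : ℕ => (stateMean φ π x w (N + 1) - stateMean φ π x w 1) / (N : ℝ))
      atTop (𝓝 0) := by
    refine tendsto_of_tendsto_of_tendsto_of_le_of_le
      (tendsto_const_div_atTop_nhds_zero_nat (-(2 * C)))
      (tendsto_const_div_atTop_nhds_zero_nat (2 * C)) (fun N => ?_) fun N => ?_
    all_goals
      have h1 := abs_le.1 (abs_stateMean_le φ π x hC (N + 1))
      have h2 := abs_le.1 (abs_stateMean_le φ π x hC 1)
      refine div_le_div_of_nonneg_right ?_ N.cast_nonneg
      linarith
  have h1 : Tendsto (fun N : ℕ => (h x - c) +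
      (stateMean φ π x w (N + 1) - stateMean φ π x w 1) / (N : ℝ)) atTop (𝓝 (h x - c)) := by
    simpa using h0.const_add (h x - c)
  refine h1.congr' ?_
  filter_upwards [eventually_ne_atTop 0] with N hN
  have : (N : ℝ) ≠ 0 := Nat.cast_ne_zero.2 hN
  rw [hsum]
  field_simp

theorem exists_hasBias [Nonempty S] {φ : MDP S A lam} (hφ : IsErgodic φ) {f : S → A} {g : ℝ}
    {h : S → ℝ} (hf : IsPoisson φ f g h) : ∃ h', HasBias φ f h' := by
  obtain ⟨c, hc⟩ := exists_tendsto_bias hφ hf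
  exact ⟨fun x => h x - c, fun _ => g, hasGain_stationary φ hf, hc⟩

theorem HasBias.isPoisson [Nonempty S] {φ : MDP S A lam} (hφ : IsErgodic φ) {f : S → A} {g : ℝ}
    {h h' : S → ℝ} (hf : IsPoisson φ f g h) (hb : HasBias φ f h') : IsPoisson φ f g h' := by
  obtain ⟨c, hc⟩ := exists_tendsto_bias hφ hf
  obtain ⟨g', hg', hb⟩ := hb
  have hgg : g' = fun _ => g := funext fun s =>
    tendsto_nhds_unique (hg' s) (hasGain_stationary φ hf s)
  subst hgg
  have hh : ∀ s, h' s = h s - c := fun s => tendsto_nhds_unique (hb s) (hc s)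
  have hone := (isIrreducibleChain_of_isErgodic hφ f).sum_eq_one
  intro s
  have := hf s
  simp only [bellman, hh, mul_sub, Finset.sum_sub_distrib, ← Finset.sum_mul, hone] at this ⊢
  linarith

/-- The selected optimal bias function solves the optimality equation. -/
theorem exists_isOptimalPair_optBias [Nonempty S] [Nonempty A] {φ : MDP S A lam}
    (hφ : IsErgodic φ) : ∃ g, IsOptimalPair φ g (optBias φ) := by
  -- The choice made by `Classical.epsilon` is meaningful only once some optimal bias is known to
  -- exist.
  have hex : ∃ h, ∃ f ∈ optimalPolicies φ, HasBias φ f h := by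
    obtain ⟨g, h, f, h1, h2⟩ := exists_isOptimalPair hφ
    obtain ⟨h', hh'⟩ := exists_hasBias hφ h2
    exact ⟨h', f, mem_optimalPolicies_of_isPoisson h1 h2, hh'⟩
  obtain ⟨f, hf, hb⟩ : ∃ f ∈ optimalPolicies φ, HasBias φ f (optBias φ) :=
    Classical.epsilon_spec hex
  obtain ⟨g, h, hgh⟩ := exists_isPoisson hφ f
  exact ⟨g, isOptimalPair_of_mem_optimalPolicies hφ (hb.isPoisson hφ hgh) hf⟩

theorem bellmanOpt_eq_of_isOptimalPair {φ : MDP S A lam} {g : ℝ} {h : S → ℝ}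
    (hgh : IsOptimalPair φ g h) (s : S) : bellmanOpt φ h s = g + h s := by
  obtain ⟨a, ha⟩ := hgh.2 s
  have : Nonempty A := ⟨a⟩
  exact le_antisymm (ciSup_le fun a => hgh.1 s a)
    (ha.le.trans (le_ciSup (f := fun a => bellman φ a h s) (Set.finite_range _).bddAbove a))

theorem gap_nonneg (φ : MDP S A lam) (s : S) (a : A) : 0 ≤ gap φ s a :=
  sub_nonneg.2 (le_ciSup (f := fun a => bellman φ a (optBias φ) s) (Set.finite_range _).bddAbove a)

theorem mem_optimalActions_iff (φ : MDP S A lam) (s : S) (a : A) :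
    a ∈ optimalActions φ s ↔ gap φ s a = 0 := by
  rw [gap, sub_eq_zero]; rfl

theorem mem_optimalPolicies_of_forall_mem [Nonempty S] [Nonempty A] {φ : MDP S A lam}
    (hφ : IsErgodic φ) {f : S → A} (hf : ∀ s, f s ∈ optimalActions φ s) :
    f ∈ optimalPolicies φ := by
  obtain ⟨g, hg⟩ := exists_isOptimalPair_optBias hφ
  refine mem_optimalPolicies_of_isPoisson hg fun s => ?_
  rw [← bellmanOpt_eq_of_isOptimalPair hg]
  exact hf s

/-- A confusing model has a state where no action is optimal for both models. -/
theorem exists_disjoint_optimalActions [Nonempty S] [Nonempty A] {φ ψ : MDP S A lam}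
    (hφ : IsErgodic φ) (hψ : IsErgodic ψ) (h : optimalPolicies φ ∩ optimalPolicies ψ = ∅) :
    ∃ s, ∀ a ∈ optimalActions φ s, a ∉ optimalActions ψ s := by
  by_contra! hc
  -- Optimality is a statewise condition, so common optimal actions glue into a common optimal
  -- policy.
  choose f hf using hc
  have : f ∈ optimalPolicies φ ∩ optimalPolicies ψ :=
    ⟨mem_optimalPolicies_of_forall_mem hφ fun s => (hf s).1,
      mem_optimalPolicies_of_forall_mem hψ fun s => (hf s).2⟩
  rw [h] at this
  exact this

/-! ### Regret -/

theorem value_le (φ : MDP S A lam) (π : Policy S A) (T : ℕ) (x : S) : value φ π T x ≤ T := by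
  rw [value_eq, ← sum_visits φ π x T]
  refine Finset.sum_le_sum fun z _ => mul_le_of_le_one_right (visits_nonneg ..) ?_
  exact (integral_mem_Icc (a := 0) (b := 1) (by fun_prop) fun r => r.2).2

/-- Up to a constant, the regret is at least the expected sum of the gaps. -/
theorem exists_sum_gap_le_regret [Nonempty S] [Nonempty A] {φ : MDP S A lam} (hφ : IsErgodic φ) :
    ∃ C, ∀ (π : Policy S A) (x : S) (T : ℕ),
      ∑ z : S × A, visits φ π x T z * gap φ z.1 z.2 ≤ regret φ π T x + C := by
  obtain ⟨g, hg⟩ := exists_isOptimalPair_optBias hφ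
  choose f hf using hg.2
  obtain ⟨C, hC⟩ := exists_abs_le (optBias φ)
  refine ⟨2 * C, fun π x T => ?_⟩
  -- The real supremum dominates its terms because all values are at most `T`.
  have h1 : value φ (Policy.stationary f) T x ≤ ⨆ π' : Policy S A, value φ π' T x :=
    le_ciSup (f := fun π' : Policy S A => value φ π' T x)
      ⟨T, by rintro _ ⟨π', rfl⟩; exact value_le φ π' T x⟩ _
  rw [value_stationary φ hf] at h1
  have h2 := value_eq_of_pair φ π x T g (optBias φ)
  have h3 : ∀ z : S × A, g + optBias φ z.1 - bellman φ z.2 (optBias φ) z.1 = gap φ z.1 z.2 :=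
    fun z => by rw [gap, bellmanOpt_eq_of_isOptimalPair hg]
  simp only [h3] at h2
  have h4 := abs_le.1 (abs_stateMean_le φ π x hC T)
  have h5 := abs_le.1 (abs_stateMean_le φ (Policy.stationary f) x hC T)
  rw [regret]
  linarith

/-! ### Numbers of visits -/

/-- Number of occurrences of state-action pairs from `Q` in a history. -/
def count (Q : Set (S × A)) (n : ℕ) (h : Fin n → Obs S A) : ℝ :=
  ∑ i, Q.indicator 1 ((h i).1, (h i).2.1)

theorem indicator_one_mem_Icc {α : Type*} (Q : Set α) (z : α) :
    Q.indicator (1 : α → ℝ) z ∈ Set.Icc (0 : ℝ) 1 :=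
  ⟨Set.indicator_nonneg (fun _ _ => zero_le_one) z,
    Set.indicator_le_self' (f := (1 : α → ℝ)) (fun _ _ => zero_le_one) z⟩

theorem measurable_indicator_pair (Q : Set (S × A)) :
    Measurable fun o : Obs S A => Q.indicator (1 : S × A → ℝ) (o.1, o.2.1) :=
  (measurable_of_countable (Q.indicator (1 : S × A → ℝ))).comp (by fun_prop)

theorem measurable_count (Q : Set (S × A)) (n : ℕ) : Measurable (count Q n) := by
  unfold count
  exact Finset.measurable_sum _ fun i _ => (measurable_indicator_pair Q).comp (measurable_pi_apply i)

theorem count_nonneg (Q : Set (S × A)) (n : ℕ) (h : Fin n → Obs S A) : 0 ≤ count Q n h :=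
  Finset.sum_nonneg fun _ _ => (indicator_one_mem_Icc Q _).1

theorem count_le (Q : Set (S × A)) (n : ℕ) (h : Fin n → Obs S A) : count Q n h ≤ n :=
  (Finset.sum_le_sum fun _ _ => (indicator_one_mem_Icc Q _).2).trans (by simp)

theorem integral_count (φ : MDP S A lam) (π : Policy S A) (x : S) (T : ℕ) (Q : Set (S × A)) :
    ∫ h, count Q T h ∂(law φ π x T) = ∑ z, visits φ π x T z * Q.indicator 1 z := by
  unfold count
  rw [integral_sum_law φ π x T (c := fun o => Q.indicator 1 (o.1, o.2.1)) (C := 1)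
    (measurable_indicator_pair Q) fun o => by
      rw [abs_of_nonneg (indicator_one_mem_Icc Q _).1]; exact (indicator_one_mem_Icc Q _).2]
  simp

theorem real_le_count_le (φ : MDP S A lam) (π : Policy S A) (x : S) (T : ℕ) (Q : Set (S × A))
    {a : ℝ} (ha : 0 < a) : (law φ π x T).real {h | a ≤ count Q T h} ≤
      (∑ z, visits φ π x T z * Q.indicator 1 z) / a := by
  rw [le_div_iff₀ ha, mul_comm, ← integral_count]
  exact mul_meas_ge_le_integral_of_nonneg (ae_of_all _ fun h => count_nonneg Q T h)
    (integrable_of_bdd (C := T) (measurable_count Q T) fun h => by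
      rw [abs_of_nonneg (count_nonneg Q T h)]; exact count_le Q T h) a

/-- Drift function forcing visits to `s`. -/
theorem exists_drift [Nonempty A] {φ : MDP S A lam} (hφ : IsErgodic φ) (s : S) :
    ∃ (w : S → ℝ) (W ρ : ℝ), 0 < ρ ∧ ρ < 1 ∧ 1 ≤ W ∧ (∀ y, w y ∈ Set.Icc 1 W) ∧
      ∀ z : S × A, z.1 ≠ s → transMean φ w z ≤ ρ * w z.1 := by
  classical
  have : Nonempty S := ⟨s⟩
  -- An auxiliary problem charges 1 for each visit to `s`. Its optimal gain is negative: otherwise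
  -- `h` would be subharmonic, hence constant, and the equation at `s` would give `g = -1`.
  obtain ⟨g, h, f, h1, h2⟩ := exists_optimality_equation
    (p := fun i a j => (φ.trans (i, a)).real {j}) (isIrreducibleChain_of_isErgodic hφ)
    (fun i _ => if i = s then -1 else 0)
  have hg : g < 0 := by
    by_contra! hg
    have hc := (isIrreducibleChain_of_isErgodic hφ f).eq_of_le (u := h) fun i => by
      have := h2 i
      split_ifs at this <;> linarith
    have h3 := h2 s
    rw [(isIrreducibleChain_of_isErgodic hφ f).sum_mul_eq hc] at h3
    simp at h3
    linarith
  obtain ⟨C, hC⟩ := exists_abs_le h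
  have hC0 : 0 ≤ C := (abs_nonneg _).trans (hC s)
  have hW : (0 : ℝ) < 2 * C + 1 := by linarith
  -- The shift puts the function in `[1, 2C + 1]`, which turns the additive drift `g` into a
  -- multiplicative one. The maximum with `1 / 2` only keeps `ρ` positive.
  refine ⟨fun y => h y + C + 1, 2 * C + 1, max (1 + g / (2 * C + 1)) (1 / 2), by positivity, ?_,
    by linarith, fun y => ?_, fun z hz => ?_⟩
  · exact max_lt (by linarith [div_neg_of_neg_of_pos hg hW]) (by norm_num)
  · have := abs_le.1 (hC y)
    constructor <;> linarith
  · have hb := abs_le.1 (hC z.1)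
    have h3 := h1 z.1 z.2
    simp only [hz, if_false, zero_add] at h3
    have h4 : transMean φ (fun y => h y + C + 1) z = transMean φ h z + C + 1 := by
      simp [transMean, mul_add, Finset.sum_add_distrib, ← Finset.sum_mul]
    have h5 : transMean φ h z ≤ g + h z.1 := h3
    have h6 : g ≤ g / (2 * C + 1) * (h z.1 + C + 1) := by
      rw [div_mul_eq_mul_div, le_div_iff₀ hW]
      exact mul_le_mul_of_nonpos_left (by linarith) hg.le
    calc transMean φ (fun y => h y + C + 1) z ≤ (1 + g / (2 * C + 1)) * (h z.1 + C + 1) := by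
          rw [h4]; linarith
      _ ≤ _ := mul_le_mul_of_nonneg_right (le_max_left _ _) (by linarith)

/-- Whatever the policy, the state `s` is visited a linear number of times. -/
theorem exists_tendsto_count_lt [Nonempty A] {φ : MDP S A lam} (hφ : IsErgodic φ) (s : S) :
    ∃ c : ℝ, 0 < c ∧ ∀ (π : Policy S A) (x : S), Tendsto (fun T : ℕ =>
      (law φ π x T).real {h | count {z | z.1 = s} T h < c * T}) atTop (𝓝 0) := by
  obtain ⟨w, W, ρ, hρ0, hρ1, hW, hw, hdrift⟩ := exists_drift (A := A) hφ s
  have hW0 : 0 < W := zero_lt_one.trans_le hW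
  -- With this `θ` the discount `exp (-θ)` at a visit to `s` offsets the missing drift there, so the
  -- weighted function contracts by `ρ` at every pair.
  set θ : ℝ := Real.log (W / ρ) with hθ
  have hθ0 : 0 < θ := Real.log_pos (by rw [one_lt_div hρ0]; linarith)
  have hexpθ : Real.exp (-θ) = ρ / W := by
    rw [Real.exp_neg, hθ, Real.exp_log (by positivity), inv_div]
  have hlogρ : Real.log ρ < 0 := Real.log_neg hρ0 hρ1
  set Q : Set (S × A) := {z | z.1 = s} with hQ
  have hone : ∀ z : S × A, Real.exp (-θ * Q.indicator 1 z) * transMean φ w z ≤ ρ * w z.1 := by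
    intro z
    by_cases hz : z.1 = s
    · have h1 : Q.indicator (1 : S × A → ℝ) z = 1 := Set.indicator_of_mem (by exact hz) _
      have h2 : transMean φ w z ≤ W := by
        rw [← integral_trans]
        exact (integral_mem_Icc (measurable_of_countable w) hw).2
      rw [h1, mul_one, hexpθ]
      calc ρ / W * transMean φ w z ≤ ρ / W * W := by gcongr
        _ = ρ * 1 := by field_simp
        _ ≤ _ := by gcongr; exact (hw z.1).1
    · have h1 : Q.indicator (1 : S × A → ℝ) z = 0 := Set.indicator_of_notMem (by exact hz) _
      rw [h1, mul_zero, Real.exp_zero, one_mul]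
      exact hdrift z hz
  -- This rate spends half of the decay `ρ ^ T` in the Chernoff bound and leaves the other half.
  refine ⟨-Real.log ρ / (2 * θ), div_pos (by linarith) (by positivity), fun π x => ?_⟩
  have hm : ∀ T, Measurable fun z : (Fin T → Obs S A) × S =>
      Real.exp (-θ * count Q T z.1) * w z.2 := fun T =>
    (((measurable_count Q T).comp measurable_fst).const_mul (-θ)).exp.mul
      ((measurable_of_countable w).comp measurable_snd)
  have hle : ∀ T (h : Fin T → Obs S A), Real.exp (-θ * count Q T h) ≤ 1 := fun T h =>
    Real.exp_le_one_iff.2 (by nlinarith [count_nonneg Q T h])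
  have hpos : ∀ T (z : (Fin T → Obs S A) × S), 0 ≤ Real.exp (-θ * count Q T z.1) * w z.2 :=
    fun T z => mul_nonneg (Real.exp_pos _).le (zero_le_one.trans (hw z.2).1)
  have hb : ∀ T (z : (Fin T → Obs S A) × S), |Real.exp (-θ * count Q T z.1) * w z.2| ≤ W :=
    fun T z => by
      rw [abs_of_nonneg (hpos T z)]
      calc Real.exp (-θ * count Q T z.1) * w z.2 ≤ 1 * W :=
            mul_le_mul (hle T z.1) (hw z.2).2 (zero_le_one.trans (hw z.2).1) zero_le_one
        _ = W := one_mul W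
  have hind : ∀ T : ℕ, ∫ z, Real.exp (-θ * count Q T z.1) * w z.2 ∂(jointLaw φ π x T) ≤
      ρ ^ T * W := by
    intro T
    induction T with
    | zero => simpa using le_of_abs_le (abs_integral_le_of_bdd (hb 0))
    | succ T ih =>
      rw [integral_jointLaw_succ φ π x T (hm (T + 1)) (hb (T + 1))]
      have h1 : ∀ z : (Fin T → Obs S A) × S, condExpStep φ π T
          (fun z => Real.exp (-θ * count Q (T + 1) z.1) * w z.2) z ≤
            ρ * (Real.exp (-θ * count Q T z.1) * w z.2) := by
        intro z
        simp only [condExpStep, count, Fin.sum_univ_castSucc, Fin.snoc_castSucc, Fin.snoc_last,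
          integral_const_mul, integral_trans, integral_const, probReal_univ, smul_eq_mul, one_mul,
          mul_add, Real.exp_add, mul_assoc]
        have := mul_le_mul_of_nonneg_left (hone (z.2, π.act T z.1 z.2))
          (Real.exp_pos (-θ * count Q T z.1)).le
        simp only [count] at this
        linarith
      calc _ ≤ ∫ z, ρ * (Real.exp (-θ * count Q T z.1) * w z.2) ∂(jointLaw φ π x T) :=
            integral_mono (integrable_of_bdd (measurable_condExpStep φ π T (hm (T + 1)))
              (abs_condExpStep_le φ π T (hb (T + 1))))
              ((integrable_of_bdd (hm T) (hb T)).const_mul ρ) h1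
        _ ≤ ρ * (ρ ^ T * W) := by rw [integral_const_mul]; gcongr
        _ = _ := by ring
  have hexp : ∀ T : ℕ, ∫ h, Real.exp (-θ * count Q T h) ∂(law φ π x T) ≤ ρ ^ T * W := by
    intro T
    have hme : Measurable fun h : Fin T → Obs S A => Real.exp (-θ * count Q T h) :=
      ((measurable_count Q T).const_mul (-θ)).exp
    have hbe : ∀ h : Fin T → Obs S A, |Real.exp (-θ * count Q T h)| ≤ 1 := fun h => by
      rw [abs_of_pos (Real.exp_pos _)]; exact hle T h
    rw [← integral_fst_jointLaw φ π x T hme hbe]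
    refine le_trans (integral_mono (integrable_of_bdd (hme.comp measurable_fst) fun z => hbe z.1)
      (integrable_of_bdd (hm T) (hb T)) fun z => ?_) (hind T)
    exact le_mul_of_one_le_right (Real.exp_pos _).le (hw z.2).1
  have hbound : ∀ T : ℕ, (law φ π x T).real {h | count Q T h < -Real.log ρ / (2 * θ) * T} ≤
      W * (Real.exp (Real.log ρ / 2)) ^ T := by
    intro T
    have h1 : (law φ π x T).real {h | count Q T h < -Real.log ρ / (2 * θ) * T} ≤
        (law φ π x T).real {h | Real.exp (T * (Real.log ρ / 2)) ≤
          Real.exp (-θ * count Q T h)} := by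
      refine measureReal_mono fun h hh => ?_
      refine Real.exp_le_exp.2 ?_
      have hh' : count Q T h < -Real.log ρ / (2 * θ) * T := hh
      have := mul_lt_mul_of_pos_left hh' hθ0
      have h2 : θ * (-Real.log ρ / (2 * θ) * T) = - (T * (Real.log ρ / 2)) := by
        field_simp
      linarith
    have h2 : Real.exp (T * (Real.log ρ / 2)) * (law φ π x T).real
        {h | Real.exp (T * (Real.log ρ / 2)) ≤ Real.exp (-θ * count Q T h)} ≤ ρ ^ T * W := by
      refine (mul_meas_ge_le_integral_of_nonneg (ae_of_all _ fun h => (Real.exp_pos _).le)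
        (integrable_of_bdd (C := 1) ((measurable_count Q T).const_mul (-θ)).exp fun h => ?_)
        _).trans (hexp T)
      rw [abs_of_pos (Real.exp_pos _)]
      exact hle T h
    have h3 : ρ ^ T = Real.exp (T * (Real.log ρ / 2)) * Real.exp (Real.log ρ / 2) ^ T := by
      rw [← Real.exp_nat_mul, ← Real.exp_add, ← mul_add, add_halves, Real.exp_nat_mul,
        Real.exp_log hρ0]
    rw [h3, mul_assoc] at h2
    have := le_of_mul_le_mul_left h2 (Real.exp_pos _)
    linarith
  refine squeeze_zero (fun T => measureReal_nonneg) hbound ?_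
  have hlt : Real.exp (Real.log ρ / 2) < 1 := Real.exp_lt_one_iff.2 (by linarith)
  simpa using (tendsto_pow_atTop_nhds_zero_of_lt_one (Real.exp_pos _).le hlt).const_mul W

/-! ### Information needed to separate two models -/

/-- Visits to suboptimal actions are controlled by the regret. -/
theorem exists_sum_visits_le_regret [Nonempty S] [Nonempty A] {φ : MDP S A lam}
    (hφ : IsErgodic φ) {Q : Set (S × A)} (hQ : ∀ z ∈ Q, z.2 ∉ optimalActions φ z.1) :
    ∃ C D, 0 ≤ D ∧ ∀ (π : Policy S A) (x : S) (T : ℕ),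
      ∑ z, visits φ π x T z * Q.indicator 1 z ≤ D * (regret φ π T x + C) := by
  obtain ⟨C, hC⟩ := exists_sum_gap_le_regret hφ
  -- `D` bounds the inverse gaps; zero gaps, whose inverse is 0 by convention, do not occur in `Q`.
  obtain ⟨D, hD⟩ := exists_abs_le fun z : S × A => (gap φ z.1 z.2)⁻¹
  have hD0 : 0 ≤ D := (abs_nonneg _).trans (hD (Classical.arbitrary _))
  refine ⟨C, D, hD0, fun π x T => ?_⟩
  refine le_trans ?_ (mul_le_mul_of_nonneg_left (hC π x T) hD0)
  rw [Finset.mul_sum]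
  refine Finset.sum_le_sum fun z _ => ?_
  rw [mul_left_comm]
  refine mul_le_mul_of_nonneg_left ?_ (visits_nonneg ..)
  by_cases hz : z ∈ Q
  · have hpos : 0 < gap φ z.1 z.2 := lt_of_le_of_ne (gap_nonneg φ z.1 z.2)
      fun h => hQ z hz ((mem_optimalActions_iff φ z.1 z.2).2 h.symm)
    rw [Set.indicator_of_mem hz, Pi.one_apply, ← inv_le_iff_one_le_mul₀ hpos]
    exact le_of_abs_le (hD z)
  · rw [Set.indicator_of_notMem hz]
    exact mul_nonneg hD0 (gap_nonneg _ _ _)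

theorem eventually_mul_add_le_rpow {u : ℕ → ℝ} {α : ℝ} (hα : 0 < α)
    (hu : u =o[atTop] fun T : ℕ => (T : ℝ) ^ α) (C D : ℝ) {κ : ℝ} (hκ : 0 < κ) :
    ∀ᶠ T : ℕ in atTop, D * (u T + C) ≤ κ * (T : ℝ) ^ α := by
  have hc : (fun _ : ℕ => C) =o[atTop] fun T : ℕ => (T : ℝ) ^ α :=
    Asymptotics.isLittleO_const_left.2 (Or.inr (tendsto_norm_atTop_atTop.comp
      ((tendsto_rpow_atTop hα).comp tendsto_natCast_atTop_atTop)))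
  filter_upwards [((hu.add hc).const_mul_left D).bound hκ] with T hT
  rw [Real.norm_of_nonneg (r := (T : ℝ) ^ α) (by positivity)] at hT
  exact (le_abs_self _).trans hT

/-- The test function equal to `l` on `E` and 0 elsewhere has exponential moment at most `1 + exp l
* P_ψ(E) ≤ 2`. An event rare under `ψ` but likely under `φ` thus forces information. -/
theorem sub_log_two_le_of_exp_mul_le {φ ψ : MDP S A lam}
    (hKL : ∀ z : S × A, KL φ ψ z.1 z.2 ≠ ∞) (π : Policy S A) (x : S) (T : ℕ)
    {E : Set (Fin T → Obs S A)} (hE : MeasurableSet E) {l : ℝ}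
    (hl : Real.exp l * (law ψ π x T).real E ≤ 1) :
    l * (law φ π x T).real E - Real.log 2 ≤
      ∑ z : S × A, visits φ π x T z * (KL φ ψ z.1 z.2).toReal := by
  set F : (Fin T → Obs S A) → ℝ := E.indicator fun _ => l with hF
  have hFm : Measurable F := measurable_const.indicator hE
  have hFb : ∀ h, |F h| ≤ |l| := fun h => by
    by_cases hh : h ∈ E <;> simp [hF, hh]
  have h1 := integral_jointLaw_le_log φ ψ hKL π x T (F := fun z => F z.1)
    (hFm.comp measurable_fst) fun z => hFb z.1
  have hexpb : ∀ h, Real.exp (F h) ∈ Set.Icc (Real.exp (-|l|)) (Real.exp |l|) := fun h =>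
    exp_mem_Icc_of_abs_le (hFb h)
  have hexpb' : ∀ h, |Real.exp (F h)| ≤ Real.exp |l| := fun h => by
    rw [abs_of_pos (Real.exp_pos _)]; exact (hexpb h).2
  rw [integral_fst_jointLaw φ π x T hFm hFb,
    integral_fst_jointLaw ψ π x T (F := fun h => Real.exp (F h)) hFm.exp hexpb',
    hF, integral_indicator_const _ hE, ← hF, smul_eq_mul] at h1
  have h2 : ∫ h, Real.exp (F h) ∂(law ψ π x T) ≤ 2 := by
    have h3 : ∫ h, Real.exp (F h) ∂(law ψ π x T) ≤
        ∫ h, (1 + E.indicator (fun _ => Real.exp l) h) ∂(law ψ π x T) := by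
      refine integral_mono (integrable_of_bdd hFm.exp hexpb')
        ((integrable_const _).add ((integrable_const _).indicator hE)) fun h => ?_
      by_cases hh : h ∈ E <;> simp [hF, hh]
    rw [integral_add (integrable_const _) ((integrable_const _).indicator hE),
      integral_indicator_const _ hE, smul_eq_mul] at h3
    simp only [integral_const, probReal_univ, smul_eq_mul, one_mul] at h3
    linarith
  have h4 : Real.log (∫ h, Real.exp (F h) ∂(law ψ π x T)) ≤ Real.log 2 :=
    Real.log_le_log ((Real.exp_pos _).trans_le (integral_mem_Icc hFm.exp hexpb).1) h2
  linarith

theorem eventually_log_le_sum_visits_mul_KL [Nonempty S] [Nonempty A] {φ ψ : MDP S A lam}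
    (hφ : IsErgodic φ) (hψ : IsErgodic ψ)
    (hdisj : optimalPolicies φ ∩ optimalPolicies ψ = ∅)
    (hKL : ∀ z : S × A, KL φ ψ z.1 z.2 ≠ ∞) (π : Policy S A) (x : S)
    (hRφ : ∀ α : ℝ, 0 < α → (fun T : ℕ => regret φ π T x) =o[atTop] fun T : ℕ => (T : ℝ) ^ α)
    (hRψ : ∀ α : ℝ, 0 < α → (fun T : ℕ => regret ψ π T x) =o[atTop] fun T : ℕ => (T : ℝ) ^ α)
    {ε : ℝ} (hε : 0 < ε) (hε1 : ε < 1) :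
    ∀ᶠ T : ℕ in atTop, (1 - ε) ^ 2 * Real.log T - Real.log 2 ≤
      ∑ z : S × A, visits φ π x T z * (KL φ ψ z.1 z.2).toReal := by
  obtain ⟨s, hs⟩ := exists_disjoint_optimalActions hφ hψ hdisj
  obtain ⟨c, hc, hcount⟩ := exists_tendsto_count_lt hφ s
  set Q : Set (S × A) := {z | z.1 = s} with hQ
  set Q₁ : Set (S × A) := {z | z.1 = s ∧ z.2 ∈ optimalActions φ s} with hQ₁
  set Q₂ : Set (S × A) := {z | z.1 = s ∧ z.2 ∉ optimalActions φ s} with hQ₂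
  have hsplit : ∀ (T : ℕ) (h : Fin T → Obs S A), count Q T h = count Q₁ T h + count Q₂ T h := by
    intro T h
    simp only [count, ← Finset.sum_add_distrib]
    refine Finset.sum_congr rfl fun i _ => ?_
    have hu : Q = Q₁ ∪ Q₂ := by
      ext z
      simp only [hQ, hQ₁, hQ₂, Set.mem_union]
      change z.1 = s ↔ (z.1 = s ∧ _) ∨ (z.1 = s ∧ _)
      tauto
    have hd : Disjoint Q₁ Q₂ := Set.disjoint_left.2 fun z h1 h2 => h2.2 h1.2
    rw [hu, Set.indicator_union_of_disjoint hd]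
  obtain ⟨C₁, D₁, hD₁, h₁⟩ := exists_sum_visits_le_regret hψ (Q := Q₁) fun z hz => by
    obtain ⟨h1, h2⟩ := hz
    rw [h1]; exact hs _ h2
  obtain ⟨C₂, D₂, hD₂, h₂⟩ := exists_sum_visits_le_regret hφ (Q := Q₂) fun z hz => by
    obtain ⟨h1, h2⟩ := hz
    rw [h1]; exact h2
  -- The constants are fitted to Markov's inequality at level `c / 2 * T`: the bound for `Q₂`
  -- becomes `ε / 2` under `φ`, and that for `Q₁` becomes `T ^ (ε - 1)` under `ψ`.
  filter_upwards [eventually_ge_atTop 1, (hcount π x).eventually_lt_const (half_pos hε),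
    eventually_mul_add_le_rpow one_pos (hRφ 1 one_pos) C₂ D₂
      (show 0 < ε / 2 * (c / 2) by positivity),
    eventually_mul_add_le_rpow hε (hRψ ε hε) C₁ D₁ (half_pos hc)] with T hT hN hM₂ hM₁
  have hT1 : (1 : ℝ) ≤ T := by exact_mod_cast hT
  have hT0 : (0 : ℝ) < T := zero_lt_one.trans_le hT1
  have ha : 0 < c / 2 * T := by positivity
  set E : Set (Fin T → Obs S A) := {h | c / 2 * T ≤ count Q₁ T h} with hEdef
  have hE : MeasurableSet E := measurableSet_le measurable_const (measurable_count Q₁ T)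
  have hψE : (law ψ π x T).real E ≤ (T : ℝ) ^ (ε - 1) := by
    refine (real_le_count_le ψ π x T Q₁ ha).trans ?_
    rw [div_le_iff₀ ha]
    refine ((h₁ π x T).trans hM₁).trans_eq ?_
    rw [Real.rpow_sub hT0, Real.rpow_one]
    field_simp
  have hφ2 : (law φ π x T).real {h | c / 2 * T ≤ count Q₂ T h} ≤ ε / 2 := by
    refine (real_le_count_le φ π x T Q₂ ha).trans ?_
    rw [div_le_iff₀ ha]
    refine ((h₂ π x T).trans hM₂).trans_eq ?_
    rw [Real.rpow_one]
    ring
  have hφE : 1 - ε ≤ (law φ π x T).real E := by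
    -- Outside `E`, either `s` is visited too rarely or suboptimal actions take up half of the
    -- required visits; each has probability at most `ε / 2`.
    have hcompl : (law φ π x T).real Eᶜ ≤ (law φ π x T).real {h | count Q T h < c * T} +
        (law φ π x T).real {h | c / 2 * T ≤ count Q₂ T h} := by
      refine (measureReal_mono fun h hh => ?_).trans (measureReal_union_le _ _)
      have hh' : count Q₁ T h < c / 2 * T := not_le.1 hh
      by_cases h2 : c / 2 * T ≤ count Q₂ T h
      · exact Or.inr h2
      · refine Or.inl ?_
        change count Q T h < c * T
        rw [hsplit]
        linarith
    rw [probReal_compl_eq_one_sub hE] at hcompl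
    linarith
  have hlog : 0 ≤ (1 - ε) * Real.log T := mul_nonneg (by linarith) (Real.log_nonneg hT1)
  have hmain := sub_log_two_le_of_exp_mul_le hKL π x T hE (l := (1 - ε) * Real.log T) (by
    have : Real.exp ((1 - ε) * Real.log T) = (T : ℝ) ^ (1 - ε) := by
      rw [Real.rpow_def_of_pos hT0, mul_comm]
    rw [this]
    calc (T : ℝ) ^ (1 - ε) * (law ψ π x T).real E ≤ (T : ℝ) ^ (1 - ε) * (T : ℝ) ^ (ε - 1) := by
          gcongr
      _ = 1 := by rw [← Real.rpow_add hT0]; simp)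
  have := mul_le_mul_of_nonneg_left hφE hlog
  nlinarith

/-! ### The lower bound -/

/-- Finiteness of `d` makes multiplication by it continuous on `[0,∞]`, so the bound passes to the
limit even where `η` is infinite. Then `ε` tends to 0. -/
theorem one_le_of_tendsto_visits {κ : Type*} [Fintype κ] {v : ℕ → κ → ℝ} {d : κ → ℝ≥0∞}
    (hd : ∀ z, d z ≠ ∞) (hv : ∀ T z, 0 ≤ v T z)
    (h : ∀ ε : ℝ, 0 < ε → ε < 1 → ∀ᶠ T : ℕ in atTop,
      (1 - ε) ^ 2 * Real.log T - Real.log 2 ≤ ∑ z, v T z * (d z).toReal)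
    {l : Filter ℕ} [l.NeBot] (hl : l ≤ atTop) {η : κ → ℝ≥0∞}
    (hη : Tendsto (fun T z => ENNReal.ofReal (v T z / Real.log T)) l (𝓝 η)) :
    1 ≤ ∑ z, η z * d z := by
  have hlim : Tendsto (fun T => ∑ z, ENNReal.ofReal (v T z / Real.log T) * d z) l
      (𝓝 (∑ z, η z * d z)) :=
    tendsto_finsetSum _ fun z _ =>
      ENNReal.Tendsto.mul_const ((tendsto_pi_nhds.1 hη) z) (Or.inr (hd z))
  have hlogT : Tendsto (fun T : ℕ => Real.log T) atTop atTop :=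
    Real.tendsto_log_atTop.comp tendsto_natCast_atTop_atTop
  have key : ∀ ε : ℝ, 0 < ε → ε < 1 → ENNReal.ofReal ((1 - ε) ^ 2) ≤ ∑ z, η z * d z := by
    intro ε hε hε1
    have h1 : Tendsto (fun T : ℕ => ENNReal.ofReal ((1 - ε) ^ 2 - Real.log 2 / Real.log T)) l
        (𝓝 (ENNReal.ofReal ((1 - ε) ^ 2))) := by
      refine ENNReal.tendsto_ofReal (Tendsto.mono_left ?_ hl)
      simpa using (hlogT.const_div_atTop (Real.log 2)).const_sub ((1 - ε) ^ 2)
    refine le_of_tendsto_of_tendsto h1 hlim ?_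
    filter_upwards [hl (h ε hε hε1), hl (hlogT.eventually_gt_atTop 0)] with T hT hT0
    have h2 : ∑ z, ENNReal.ofReal (v T z / Real.log T) * d z =
        ENNReal.ofReal ((∑ z, v T z * (d z).toReal) / Real.log T) := by
      rw [Finset.sum_div, ENNReal.ofReal_sum_of_nonneg fun z _ => by
        have := hv T z
        positivity]
      refine Finset.sum_congr rfl fun z _ => ?_
      rw [mul_div_right_comm, ENNReal.ofReal_mul (div_nonneg (hv T z) hT0.le),
        ENNReal.ofReal_toReal (hd z)]
    rw [h2]
    refine ENNReal.ofReal_le_ofReal ?_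
    rw [le_div_iff₀ hT0, sub_mul, div_mul_cancel₀ _ hT0.ne']
    exact hT
  have h3 : Tendsto (fun ε : ℝ => ENNReal.ofReal ((1 - ε) ^ 2)) (𝓝[>] 0) (𝓝 1) := by
    have : Tendsto (fun ε : ℝ => ENNReal.ofReal ((1 - ε) ^ 2)) (𝓝 0)
        (𝓝 (ENNReal.ofReal ((1 - 0) ^ 2))) :=
      ENNReal.tendsto_ofReal (Continuous.tendsto (by fun_prop) 0)
    simpa using this.mono_left nhdsWithin_le_nhds
  refine le_of_tendsto h3 ?_
  filter_upwards [Ioo_mem_nhdsGT (zero_lt_one (α := ℝ))] with ε hε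
  exact key ε hε.1 hε.2

theorem exists_real_of_liminf_lt {u : ℕ → ℝ} {K : ℝ≥0∞}
    (h : liminf (fun T => ((u T : ℝ) : EReal)) atTop < (K : EReal)) :
    ∃ L : ℝ, (L : EReal) < (K : EReal) ∧ ∃ᶠ T in atTop, u T < L := by
  obtain ⟨L, hL1, hL2⟩ := EReal.lt_iff_exists_real_btwn.1 h
  refine ⟨L, hL2, (frequently_lt_of_liminf_lt (by isBoundedDefault) hL1).mono fun T hT => ?_⟩
  exact_mod_cast hT

theorem lowerBoundConst_le_liminf (Φ : Set (MDP S A lam)) (φ : MDP S A lam) (hφ : φ ∈ Φ)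
    (herg : IsErgodic φ) (π : Policy S A) (hπ : UniformlyGood Φ π) (x : S) :
    ((lowerBoundConst Φ φ : ℝ≥0∞) : EReal) ≤
      liminf (fun T : ℕ => ((regret φ π T x / Real.log T : ℝ) : EReal)) atTop := by
  have : Nonempty S := ⟨x⟩
  have : Nonempty A := ⟨π.act 0 (fun i => i.elim0) x⟩
  by_contra! hlt
  obtain ⟨L, hLK, hfreq⟩ := exists_real_of_liminf_lt hlt
  obtain ⟨C, hC⟩ := exists_sum_gap_le_regret herg
  -- An ultrafilter on the times of small regret makes all normalised visit counts converge
  -- together.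
  obtain ⟨U, hU⟩ := exists_ultrafilter_iff.2
    (frequently_mem_iff_neBot.1 hfreq)
  have hUtop : (U : Filter ℕ) ≤ atTop := hU.trans inf_le_left
  have hUL : ∀ᶠ T in (U : Filter ℕ), regret φ π T x / Real.log T < L :=
    le_principal_iff.1 (hU.trans inf_le_right)
  set v : ℕ → S × A → ℝ≥0∞ := fun T z => ENNReal.ofReal (visits φ π x T z / Real.log T) with hv
  obtain ⟨η, -, hη⟩ := isCompact_univ.ultrafilter_le_nhds (U.map v) (by simp)
  have hη' : Tendsto v (U : Filter ℕ) (𝓝 η) := hη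
  have hlogT : Tendsto (fun T : ℕ => Real.log T) atTop atTop :=
    Real.tendsto_log_atTop.comp tendsto_natCast_atTop_atTop
  have hcost : ∑ z : S × A, η z * ENNReal.ofReal (gap φ z.1 z.2) ≤ ENNReal.ofReal L := by
    have h1 : Tendsto (fun T => ∑ z : S × A, v T z * ENNReal.ofReal (gap φ z.1 z.2))
        (U : Filter ℕ) (𝓝 (∑ z : S × A, η z * ENNReal.ofReal (gap φ z.1 z.2))) :=
      tendsto_finsetSum _ fun z _ =>
        ENNReal.Tendsto.mul_const ((tendsto_pi_nhds.1 hη') z) (Or.inr ENNReal.ofReal_ne_top)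
    have h2 : Tendsto (fun T : ℕ => ENNReal.ofReal (L + C / Real.log T)) (U : Filter ℕ)
        (𝓝 (ENNReal.ofReal L)) := by
      refine ENNReal.tendsto_ofReal (Tendsto.mono_left ?_ hUtop)
      simpa using (hlogT.const_div_atTop C).const_add L
    refine le_of_tendsto_of_tendsto h1 h2 ?_
    filter_upwards [hUL, hUtop (hlogT.eventually_gt_atTop 0)] with T hT hT0
    have h3 : ∑ z : S × A, v T z * ENNReal.ofReal (gap φ z.1 z.2) =
        ENNReal.ofReal ((∑ z : S × A, visits φ π x T z * gap φ z.1 z.2) / Real.log T) := by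
      rw [Finset.sum_div, ENNReal.ofReal_sum_of_nonneg fun z _ =>
        div_nonneg (mul_nonneg (visits_nonneg ..) (gap_nonneg _ _ _)) hT0.le]
      refine Finset.sum_congr rfl fun z _ => ?_
      rw [mul_div_right_comm, ENNReal.ofReal_mul (div_nonneg (visits_nonneg ..) hT0.le)]
    rw [h3]
    refine ENNReal.ofReal_le_ofReal ?_
    calc _ ≤ (regret φ π T x + C) / Real.log T := by gcongr; exact hC π x T
      _ ≤ _ := by rw [add_div]; gcongr
  -- Needed since `ENNReal.ofReal` truncates: a negative `L` would be lost when going back to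
  -- `EReal`.
  have hL0 : 0 ≤ L := by
    have h2 : Tendsto (fun T : ℕ => L + C / Real.log T) (U : Filter ℕ) (𝓝 L) := by
      refine Tendsto.mono_left ?_ hUtop
      simpa using (hlogT.const_div_atTop C).const_add L
    refine ge_of_tendsto h2 ?_
    filter_upwards [hUL, hUtop (hlogT.eventually_gt_atTop 0)] with T hT hT0
    have h3 : 0 ≤ regret φ π T x + C := le_trans (Finset.sum_nonneg fun z _ =>
      mul_nonneg (visits_nonneg ..) (gap_nonneg _ _ _)) (hC π x T)
    have h4 := div_nonneg h3 hT0.le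
    rw [add_div] at h4
    linarith
  -- The limit itself may vanish at a pair of infinite divergence, where `0 * ∞ = 0` would spoil the
  -- constraint; adding `ε` makes that term infinite.
  have hfeas : ∀ ε : ℝ≥0∞, 0 < ε → (fun z => η z + ε) ∈ feasible Φ φ := by
    intro ε hε ψ hψ
    obtain ⟨hψΦ, hac, -, hdisj⟩ := hψ
    by_cases hKL : ∀ z : S × A, KL φ ψ z.1 z.2 ≠ ∞
    · have hψerg := herg.of_absCont hac
      refine (one_le_of_tendsto_visits hKL (fun T z => visits_nonneg φ π x T z)
        (fun ε hε hε1 => eventually_log_le_sum_visits_mul_KL herg hψerg hdisj hKL π x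
          (hπ φ hφ herg x) (hπ ψ hψΦ hψerg x) hε hε1) hUtop hη').trans ?_
      exact Finset.sum_le_sum fun z _ => by gcongr; exact le_self_add
    · push Not at hKL
      obtain ⟨z, hz⟩ := hKL
      have h1 : (η z + ε) * KL φ ψ z.1 z.2 = ∞ := by
        rw [hz]
        exact ENNReal.mul_top (by simp [hε.ne'])
      have h2 := Finset.single_le_sum (f := fun z : S × A => (η z + ε) * KL φ ψ z.1 z.2)
        (fun _ _ => zero_le) (Finset.mem_univ z)
      rw [h1] at h2
      exact le_top.trans h2
  have hle : lowerBoundConst Φ φ ≤ ENNReal.ofReal L := by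
    have h1 : ∀ ε : ℝ≥0∞, 0 < ε → lowerBoundConst Φ φ ≤
        ENNReal.ofReal L + ε * ∑ z : S × A, ENNReal.ofReal (gap φ z.1 z.2) := by
      intro ε hε
      refine (iInf₂_le _ (hfeas ε hε)).trans ?_
      simp only [add_mul, Finset.sum_add_distrib, Finset.mul_sum]
      gcongr
    have h2 : Tendsto (fun ε : ℝ≥0∞ => ENNReal.ofReal L +
        ε * ∑ z : S × A, ENNReal.ofReal (gap φ z.1 z.2)) (𝓝[>] 0) (𝓝 (ENNReal.ofReal L)) := by
      have h3 : Tendsto (fun ε : ℝ≥0∞ => ε * ∑ z : S × A, ENNReal.ofReal (gap φ z.1 z.2)) (𝓝 0)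
          (𝓝 (0 * ∑ z : S × A, ENNReal.ofReal (gap φ z.1 z.2))) :=
        ENNReal.Tendsto.mul_const tendsto_id
          (Or.inr (ENNReal.sum_ne_top.2 fun _ _ => ENNReal.ofReal_ne_top))
      simpa using (h3.mono_left nhdsWithin_le_nhds).const_add (ENNReal.ofReal L)
    exact ge_of_tendsto h2 (eventually_nhdsWithin_of_forall fun ε hε => h1 ε hε)
  have h1 : ((lowerBoundConst Φ φ : ℝ≥0∞) : EReal) ≤ ((ENNReal.ofReal L : ℝ≥0∞) : EReal) :=
    EReal.coe_ennreal_le_coe_ennreal_iff.2 hle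
  rw [EReal.coe_ennreal_ofReal, max_eq_left hL0] at h1
  exact absurd hLK (not_lt.2 h1)

end StructuredMDP

end

theorem theorem1 {S A : Type*} [Fintype S] [MeasurableSpace S] [MeasurableSingletonClass S]
    [Fintype A] [MeasurableSpace A] [MeasurableSingletonClass A]
    (lam : Measure unitInterval) (Φ : Set (StructuredMDP.MDP S A lam))
    (φ : StructuredMDP.MDP S A lam) (hφ : φ ∈ Φ) (herg : StructuredMDP.IsErgodic φ)
    (π : StructuredMDP.Policy S A) (hπ : StructuredMDP.UniformlyGood Φ π) (x : S) :
    ((StructuredMDP.lowerBoundConst Φ φ : ℝ≥0∞) : EReal) ≤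
      liminf (fun T : ℕ => ((StructuredMDP.regret φ π T x / Real.log T : ℝ) : EReal)) atTop := by
  exact StructuredMDP.lowerBoundConst_le_liminf Φ φ hφ herg π hπ x
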